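/- Let $\lambda\in(3/4,1)$ and $f(n)=n^\lambda+1$ for $n\in\mathbb N=\{0,1,2,\dots\}$. **Notation.** On $\ell^2(\mathbb N)$ let $L$ be the left shift, $(L\varphi)(n)=\varphi(n+1)$, and let $N$ be the number operator; for $u:\mathbb N\to\mathbb R$, $u(N)$ is multiplication by $u$ on its maximal domain. Put $\Delta_k(u,n)=u(n+k)-u(n)$. Products and sums of unbounded operators have their natural domains. For strictly increasing $u$ set $$T_{u,m}=i\sum_{k=1}^m\bigl((L^*)^k\Delta_k(u,N)^{-1}-\Delta_k(u,N)^{-1}L^k\bigr),\qquad T_u\varphi=\lim_{m\to\infty}T_{u,m}\varphi,$$ where $\mathrm D(T_u)$ consists of all $\varphi\in\bigcap_{m\ge1}\mathrm D(T_{u,m})$ for which the limit exists in $\ell^2(\mathbb N)$. For $\beta\ge 0$, $\mathcal M_{\mathrm s}(\beta)$ is the set of all strictly increasing $u:\mathbb N\to\mathbb R$ with $u(0)>0$ and $1/u\in\ell^2(\mathbb N)$ for which there are $g:\mathbb N\to(0,\infty)$, $h\in\ell^1(\mathbb N_{\ge1},\mathbb R)$ and $C>0$ such that $u^2/g\in\ell^1(\mathbb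 N)$, $$\frac{g(n)}{\bigl(u(n)^\beta\Delta_k(u^2,n)\bigr)^2}\le h(k)^2\quad(n\in\mathbb N,\ k\ge1),\qquad \sup_{n\in\mathbb N}\sum_{k=1}^n\frac{g(n)}{\bigl(u(n-k)^\beta(u(n)^2-u(n-k)^2)\bigr)^2}<C.$$ A CCR-domain for operators $H,T$ is a nonzero subspace of $\mathrm D(HT)\cap\mathrm D(TH)$ on which $HT-TH=-i$. A time operator of a self-adjoint operator $H$ is a densely defined symmetric operator $T$ for which a CCR-domain exists. **Claim.** 1. $f\in\mathcal M_{\mathrm s}(1)$. 2. $T_f$ is unbounded, that is, there is no finite $C$ with $\|T_f\varphi\|\le C\|\varphi\|$ for all $\varphi\in\mathrm D(T_f)$. 3. $T_f$ is closable and, for every $\gamma\in\mathbb R\setminus\{0\}$, the operator $\overline{T_f}+\gamma f(N)^2$ is self-adjoint and is a time operator of the self-adjoint operator $f(N)$ with a dense CCR-domain. -/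

import Mathlib

open Filter Topology

noncomputable section

namespace GalaponTime

/-- The complex Hilbert space `ℓ²(ℕ)`. -/
abbrev EllTwo : Type := lp (fun _ : ℕ => ℂ) 2

/-! ### Unbounded operators -/

section Unbounded

variable {H : Type*} [NormedAddCommGroup H] [InnerProductSpace ℂ H]

/-- The product `A B` of two unbounded operators on its natural domain
`{φ ∈ D(B) | B φ ∈ D(A)}`. -/
def opMul (A B : H →ₗ.[ℂ] H) : H →ₗ.[ℂ] H where
  domain :=
    { carrier := {φ | ∃ h : φ ∈ B.domain, B ⟨φ, h⟩ ∈ A.domain}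
      add_mem' := by
        rintro φ ψ ⟨hφ, hφ'⟩ ⟨hψ, hψ'⟩
        refine ⟨B.domain.add_mem hφ hψ, ?_⟩
        have e := B.map_add ⟨φ, hφ⟩ ⟨ψ, hψ⟩
        rw [AddMemClass.mk_add_mk] at e
        rw [e]
        exact A.domain.add_mem hφ' hψ'
      zero_mem' := by
        refine ⟨B.domain.zero_mem, ?_⟩
        have e : B ⟨0, B.domain.zero_mem⟩ = 0 := B.map_zero
        rw [e]
        exact A.domain.zero_mem
      smul_mem' := by
        rintro c φ ⟨hφ, hφ'⟩
        refine ⟨B.domain.smul_mem c hφ, ?_⟩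
        have e := B.map_smul c ⟨φ, hφ⟩
        rw [SetLike.mk_smul_mk] at e
        rw [e]
        exact A.domain.smul_mem c hφ' }
  toFun :=
    { toFun := fun φ => A ⟨B ⟨φ, φ.2.fst⟩, φ.2.snd⟩
      map_add' := by
        rintro ⟨φ, hφ, hφ'⟩ ⟨ψ, hψ, hψ'⟩
        rw [← A.map_add]
        congr 1
        exact Subtype.ext (B.map_add ⟨φ, hφ⟩ ⟨ψ, hψ⟩)
      map_smul' := by
        rintro c ⟨φ, hφ, hφ'⟩
        rw [RingHom.id_apply, ← A.map_smul]
        congr 1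
        exact Subtype.ext (B.map_smul c ⟨φ, hφ⟩) }

/-- The strong limit of a sequence `A 1, A 2, …` of unbounded operators: its domain consists of
all `φ ∈ ⋂_{m ≥ 1} D(A m)` for which `lim_{m → ∞} A m φ` exists, and it sends `φ` to that limit. -/
def strongLim (A : ℕ → H →ₗ.[ℂ] H) : H →ₗ.[ℂ] H where
  domain :=
    { carrier := {φ | ∃ ψ : H, ∃ h : ∀ m : ℕ, φ ∈ (A (m + 1)).domain,
        Tendsto (fun m : ℕ => A (m + 1) ⟨φ, h m⟩) atTop (𝓝 ψ)}
      add_mem' := by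
        rintro φ₁ φ₂ ⟨ψ₁, h₁, t₁⟩ ⟨ψ₂, h₂, t₂⟩
        refine ⟨ψ₁ + ψ₂, fun m => (A (m + 1)).domain.add_mem (h₁ m) (h₂ m), ?_⟩
        refine (t₁.add t₂).congr fun m => ?_
        exact ((A (m + 1)).map_add ⟨φ₁, h₁ m⟩ ⟨φ₂, h₂ m⟩).symm
      zero_mem' := by
        refine ⟨0, fun m => (A (m + 1)).domain.zero_mem, ?_⟩
        refine tendsto_const_nhds.congr fun m => ?_
        exact ((A (m + 1)).map_zero).symm
      smul_mem' := by
        rintro c φ ⟨ψ, h, t⟩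
        refine ⟨c • ψ, fun m => (A (m + 1)).domain.smul_mem c (h m), ?_⟩
        refine (t.const_smul c).congr fun m => ?_
        exact ((A (m + 1)).map_smul c ⟨φ, h m⟩).symm }
  toFun :=
    { toFun := fun φ => φ.2.choose
      map_add' := by
        intro φ₁ φ₂
        obtain ⟨h, t⟩ := (φ₁ + φ₂).2.choose_spec
        obtain ⟨h₁, t₁⟩ := φ₁.2.choose_spec
        obtain ⟨h₂, t₂⟩ := φ₂.2.choose_spec
        refine tendsto_nhds_unique t ((t₁.add t₂).congr fun m => ?_)
        exact ((A (m + 1)).map_add ⟨φ₁, h₁ m⟩ ⟨φ₂, h₂ m⟩).symm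
      map_smul' := by
        intro c φ
        obtain ⟨h, t⟩ := (c • φ).2.choose_spec
        obtain ⟨h', t'⟩ := φ.2.choose_spec
        refine tendsto_nhds_unique t ((t'.const_smul c).congr fun m => ?_)
        exact ((A (m + 1)).map_smul c ⟨φ, h' m⟩).symm }

/-- `T` is an unbounded operator: there is no finite `C` with `‖T φ‖ ≤ C ‖φ‖` on `D(T)`. -/
def IsUnbounded (T : H →ₗ.[ℂ] H) : Prop :=
  ¬ ∃ C : ℝ, ∀ φ : T.domain, ‖T φ‖ ≤ C * ‖(φ : H)‖

/-- `T` is densely defined and symmetric. -/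
def IsSymmetricOp (T : H →ₗ.[ℂ] H) : Prop :=
  Dense (T.domain : Set H) ∧ T.IsFormalAdjoint T

/-- `D` is a CCR-domain for `A` and `T`: a nonzero subspace of `D(AT) ∩ D(TA)` on which
`AT - TA = -i`. (The difference of two operators has the intersection of their domains as its
domain.) -/
def IsCCRDomain (A T : H →ₗ.[ℂ] H) (D : Submodule ℂ H) : Prop :=
  D ≠ ⊥ ∧ ∀ φ ∈ D, ∃ hφ : φ ∈ (opMul A T - opMul T A).domain,
    (opMul A T - opMul T A) ⟨φ, hφ⟩ = -(Complex.I • φ)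

/-- `T` is a time operator of the self-adjoint operator `A`. -/
def IsTimeOperator [CompleteSpace H] (A T : H →ₗ.[ℂ] H) : Prop :=
  IsSelfAdjoint A ∧ IsSymmetricOp T ∧ ∃ D : Submodule ℂ H, IsCCRDomain A T D

end Unbounded

/-! ### Operators on `ℓ²(ℕ)` -/

/-- The operator `f(N)`, where `N` is the number operator: multiplication by `f` on its maximal
domain `{φ ∈ ℓ²(ℕ) | f φ ∈ ℓ²(ℕ)}`. -/
def funN (f : ℕ → ℝ) : EllTwo →ₗ.[ℂ] EllTwo where
  domain :=
    { carrier := {φ | Memℓp (fun n : ℕ => (f n : ℂ) * φ n) 2}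
      add_mem' := by
        intro φ ψ hφ hψ
        refine Eq.mpr (congrArg (fun u => Memℓp u 2) ?_) (Memℓp.add hφ hψ)
        funext n
        simp [mul_add]
      zero_mem' := by
        refine Eq.mpr (congrArg (fun u => Memℓp u 2) ?_)
          (zero_memℓp (E := fun _ : ℕ => ℂ) (p := 2))
        funext n
        simp
      smul_mem' := by
        intro c φ hφ
        refine Eq.mpr (congrArg (fun u => Memℓp u 2) ?_) (Memℓp.const_smul hφ c)
        funext n
        simp [mul_left_comm] }
  toFun :=
    { toFun := fun φ => ⟨fun n : ℕ => (f n : ℂ) * (φ : EllTwo) n, φ.2⟩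
      map_add' := by
        intro φ ψ
        ext n
        exact mul_add (f n : ℂ) ((φ : EllTwo) n) ((ψ : EllTwo) n)
      map_smul' := by
        intro c φ
        ext n
        exact mul_left_comm (f n : ℂ) c ((φ : EllTwo) n) }

/-- The left shift `(L φ)(n) = φ(n + 1)` on `ℓ²(ℕ)`. -/
def leftShift : EllTwo →L[ℂ] EllTwo :=
  LinearMap.mkContinuous
    { toFun := fun φ => ⟨fun n : ℕ => φ (n + 1), by
        have h := (memℓp_gen_iff (p := 2) (by norm_num)).1 (lp.memℓp φ)
        exact memℓp_gen ((summable_nat_add_iff 1).2 h)⟩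
      map_add' := fun φ ψ => by ext n; rfl
      map_smul' := fun c φ => by ext n; rfl }
    1 (by
      intro φ
      rw [one_mul]
      refine lp.norm_le_of_forall_sum_le (by norm_num) (norm_nonneg φ) fun s => ?_
      refine le_trans (le_of_eq ?_)
        (lp.sum_rpow_le_norm_rpow (by norm_num) φ (s.map (addRightEmbedding 1)))
      rw [Finset.sum_map]
      rfl)

/-- A bounded operator as an everywhere defined operator. -/
def ofBounded (B : EllTwo →L[ℂ] EllTwo) : EllTwo →ₗ.[ℂ] EllTwo :=
  (B : EllTwo →ₗ[ℂ] EllTwo).toPMap ⊤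

/-- `Δ_k(f, n) = f(n + k) - f(n)`. -/
def delta (k : ℕ) (f : ℕ → ℝ) (n : ℕ) : ℝ := f (n + k) - f n

/-- `T_{f,m} = i ∑_{k=1}^m ((L*)^k Δ_k(f,N)⁻¹ - Δ_k(f,N)⁻¹ L^k)`, with the natural domain. -/
def timeOpTrunc (f : ℕ → ℝ) (m : ℕ) : EllTwo →ₗ.[ℂ] EllTwo :=
  Complex.I • ∑ k ∈ Finset.Icc 1 m,
    (opMul (ofBounded (ContinuousLinearMap.adjoint leftShift ^ k)) (funN (delta k f)).inverse
      - opMul (funN (delta k f)).inverse (ofBounded (leftShift ^ k)))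

/-- `T_f φ = lim_{m → ∞} T_{f,m} φ`, for all `φ ∈ ⋂_{m ≥ 1} D(T_{f,m})` for which the limit
exists. -/
def timeOp (f : ℕ → ℝ) : EllTwo →ₗ.[ℂ] EllTwo :=
  strongLim (timeOpTrunc f)

/-! ### Classes of functions on `ℕ` -/

/-- The class `𝒦`: `f(0) > 0` and `f` is strictly increasing. -/
def ClassK : Set (ℕ → ℝ) :=
  {f | 0 < f 0 ∧ ∀ n : ℕ, f n < f (n + 1)}

/-- The class `𝒦⁻`: `f ∈ 𝒦` and `1 / f ∈ ℓ²(ℕ)`. -/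
def ClassKMinus : Set (ℕ → ℝ) :=
  {f | f ∈ ClassK ∧ Summable fun n : ℕ => (1 / f n) ^ 2}

/-- The pair `(g, h)`, with `g : ℕ → (0, ∞)` and `h ∈ ℓ¹(ℕ_{≥1}, ℝ)`, witnesses that `f` belongs
to `𝓜(β)`. -/
structure IsWitness (β : ℝ) (f g : ℕ → ℝ) (h : ℕ+ → ℝ) : Prop where
  g_pos : ∀ n : ℕ, 0 < g n
  h_summable : Summable fun k : ℕ+ => |h k|
  summable_div : Summable fun n : ℕ => f n ^ 2 / g n
  bound : ∀ (n : ℕ) (k : ℕ+),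
    g n / (f n ^ β * delta (k : ℕ) (fun j => f j ^ 2) n) ^ 2 ≤ h k ^ 2

/-- The class `𝓜(β)`, `β ≥ 0`. -/
def ClassM (β : ℝ) : Set (ℕ → ℝ) :=
  {f | f ∈ ClassKMinus ∧ ∃ (g : ℕ → ℝ) (h : ℕ+ → ℝ), IsWitness β f g h}

/-- The class `𝓜_s(β)`, `β ≥ 0`: the supremum bound holds for the same function `g` that
witnesses membership in `𝓜(β)`. -/
def ClassMs (β : ℝ) : Set (ℕ → ℝ) :=
  {f | f ∈ ClassKMinus ∧ ∃ (g : ℕ → ℝ) (h : ℕ+ → ℝ), IsWitness β f g h ∧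
    ∃ C : ℝ, 0 < C ∧ ∀ n : ℕ,
      ∑ k ∈ Finset.Icc 1 n, g n / (f (n - k) ^ β * (f n ^ 2 - f (n - k) ^ 2)) ^ 2 < C}

end GalaponTime

end

/-! In the standard basis, T_f is the matrix with entries i/(f(n) - f(j)) off the diagonal and 0 on
it. Concavity of f bounds |f(n) - f(j)| below by l |n-j|^l (j+1)^(l-1), so column j lies in ℓ² with
squared norm O((j+1)^(2-2l)). Hence T_f is densely defined; it is symmetric, thus closable, and
unbounded because the entry 1/(f(j+1) - f(j)) tends to infinity.

Self-adjointness (`isSelfAdjoint_add_sq`): with v_j the columns of T_f and d_j = γ f(j)² + iμ,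
putting x = d⁻¹χ turns (closure of T_f + γ f(N)² + iμ) x = z into χ + Bχ = z, where B has columns
v_j/d_j. Since ∑ ‖v_j‖²/f(j)⁴ converges, the Hilbert–Schmidt norm of B is below 1 for large μ, and a
Neumann series solves the equation. The same holds for -μ, and `isSelfAdjoint_of_surjective`
concludes, for any γ ≠ 0.

CCR (`isCCRDomain_sumZero`): f(N)² commutes with f(N), and the commutator of f(N) with the matrix
has every off-diagonal entry i and zero diagonal. On finite vectors of coordinate sum zero this acts
as -i, and such vectors are dense.

Membership in the class (`powerFun_mem_classMs`) is an exponent count with the weight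
(n+1)^(4l-1/2). -/

noncomputable section

namespace GalaponTime

open scoped InnerProductSpace

/-! ### Unbounded operators through their graphs -/

section Graph

variable {H : Type*} [NormedAddCommGroup H] [InnerProductSpace ℂ H]

/-- Working with pairs in the graph carries domain and value together and avoids dependent domain
proofs in sums, products and limits. -/
lemma mem_graph_iff_exists {A : H →ₗ.[ℂ] H} {x y : H} :
    (x, y) ∈ A.graph ↔ ∃ h : x ∈ A.domain, A ⟨x, h⟩ = y := by
  rw [LinearPMap.mem_graph_iff]
  constructor
  · rintro ⟨⟨z, hz⟩, rfl, h⟩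
    exact ⟨hz, h⟩
  · rintro ⟨h, rfl⟩
    exact ⟨⟨x, h⟩, rfl, rfl⟩

lemma mem_graph_add_iff {A B : H →ₗ.[ℂ] H} {x z : H} :
    (x, z) ∈ (A + B).graph ↔ ∃ y₁ y₂, (x, y₁) ∈ A.graph ∧ (x, y₂) ∈ B.graph ∧ y₁ + y₂ = z := by
  simp only [mem_graph_iff_exists]
  constructor
  · rintro ⟨h, rfl⟩
    exact ⟨_, _, ⟨h.1, rfl⟩, ⟨h.2, rfl⟩, rfl⟩
  · rintro ⟨_, _, ⟨h₁, rfl⟩, ⟨h₂, rfl⟩, rfl⟩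
    exact ⟨⟨h₁, h₂⟩, rfl⟩

lemma mem_graph_sub_iff {A B : H →ₗ.[ℂ] H} {x z : H} :
    (x, z) ∈ (A - B).graph ↔ ∃ y₁ y₂, (x, y₁) ∈ A.graph ∧ (x, y₂) ∈ B.graph ∧ y₁ - y₂ = z := by
  simp only [mem_graph_iff_exists]
  constructor
  · rintro ⟨h, rfl⟩
    exact ⟨_, _, ⟨h.1, rfl⟩, ⟨h.2, rfl⟩, rfl⟩
  · rintro ⟨_, _, ⟨h₁, rfl⟩, ⟨h₂, rfl⟩, rfl⟩
    exact ⟨⟨h₁, h₂⟩, rfl⟩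

lemma mem_graph_smul_iff {A : H →ₗ.[ℂ] H} {c : ℂ} {x z : H} :
    (x, z) ∈ (c • A).graph ↔ ∃ y, (x, y) ∈ A.graph ∧ c • y = z := by
  simp only [mem_graph_iff_exists]
  constructor
  · rintro ⟨h, rfl⟩
    exact ⟨_, ⟨h, rfl⟩, rfl⟩
  · rintro ⟨_, ⟨h₁, rfl⟩, rfl⟩
    exact ⟨h₁, rfl⟩

lemma mem_graph_opMul_iff {A B : H →ₗ.[ℂ] H} {x z : H} :
    (x, z) ∈ (opMul A B).graph ↔ ∃ y, (x, y) ∈ B.graph ∧ (y, z) ∈ A.graph := by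
  simp only [mem_graph_iff_exists]
  constructor
  · rintro ⟨h, rfl⟩
    exact ⟨_, ⟨h.fst, rfl⟩, ⟨h.snd, rfl⟩⟩
  · rintro ⟨_, ⟨h₁, rfl⟩, ⟨h₂, rfl⟩⟩
    exact ⟨⟨h₁, h₂⟩, rfl⟩

lemma mem_graph_sum {ι : Type*} (s : Finset ι) {A : ι → H →ₗ.[ℂ] H} {x : H} {y : ι → H}
    (h : ∀ i ∈ s, (x, y i) ∈ (A i).graph) : (x, ∑ i ∈ s, y i) ∈ (∑ i ∈ s, A i).graph := by
  classical
  induction s using Finset.induction_on with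
  | empty => exact mem_graph_iff_exists.2 ⟨Submodule.mem_top, by simp⟩
  | insert a s ha ih =>
    rw [Finset.sum_insert ha, Finset.sum_insert ha]
    exact mem_graph_add_iff.2 ⟨_, _, h a (Finset.mem_insert_self a s),
      ih fun i hi => h i (Finset.mem_insert_of_mem hi), rfl⟩

lemma mem_graph_strongLim_iff {A : ℕ → H →ₗ.[ℂ] H} {x z : H} :
    (x, z) ∈ (strongLim A).graph ↔
      ∃ y : ℕ → H, (∀ m, (x, y m) ∈ (A (m + 1)).graph) ∧ Tendsto y atTop (𝓝 z) := by
  constructor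
  · intro hx
    obtain ⟨h, rfl⟩ := mem_graph_iff_exists.1 hx
    obtain ⟨h', t⟩ := h.choose_spec
    exact ⟨_, fun m => mem_graph_iff_exists.2 ⟨h' m, rfl⟩, t⟩
  · rintro ⟨y, hy, t⟩
    have hm : ∀ m, x ∈ (A (m + 1)).domain := fun m => (mem_graph_iff_exists.1 (hy m)).fst
    have e : ∀ m, A (m + 1) ⟨x, hm m⟩ = y m := fun m => (mem_graph_iff_exists.1 (hy m)).snd
    have hx : x ∈ (strongLim A).domain := ⟨z, hm, by simpa only [e] using t⟩
    refine mem_graph_iff_exists.2 ⟨hx, ?_⟩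
    obtain ⟨h', t'⟩ := hx.choose_spec
    refine tendsto_nhds_unique t' ?_
    simpa only [e] using t

lemma isFormalAdjoint_iff {A B : H →ₗ.[ℂ] H} :
    A.IsFormalAdjoint B ↔ ∀ x x' y y', (x, x') ∈ A.graph → (y, y') ∈ B.graph →
      ⟪x', y⟫_ℂ = ⟪x, y'⟫_ℂ := by
  constructor
  · intro h x x' y y' hx hy
    obtain ⟨hx₀, rfl⟩ := mem_graph_iff_exists.1 hx
    obtain ⟨hy₀, rfl⟩ := mem_graph_iff_exists.1 hy
    exact h ⟨x, hx₀⟩ ⟨y, hy₀⟩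
  · intro h x y
    exact h _ _ _ _ (A.mem_graph x) (B.mem_graph y)

lemma isFormalAdjoint_add {A A' B B' : H →ₗ.[ℂ] H} (hA : A.IsFormalAdjoint A')
    (hB : B.IsFormalAdjoint B') : (A + B).IsFormalAdjoint (A' + B') := by
  rw [isFormalAdjoint_iff] at *
  intro x x' y y' hx hy
  obtain ⟨x₁, x₂, h₁, h₂, rfl⟩ := mem_graph_add_iff.1 hx
  obtain ⟨y₁, y₂, k₁, k₂, rfl⟩ := mem_graph_add_iff.1 hy
  rw [inner_add_left, inner_add_right, hA _ _ _ _ h₁ k₁, hB _ _ _ _ h₂ k₂]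

lemma isFormalAdjoint_sub {A A' B B' : H →ₗ.[ℂ] H} (hA : A.IsFormalAdjoint A')
    (hB : B.IsFormalAdjoint B') : (A - B).IsFormalAdjoint (A' - B') := by
  rw [isFormalAdjoint_iff] at *
  intro x x' y y' hx hy
  obtain ⟨x₁, x₂, h₁, h₂, rfl⟩ := mem_graph_sub_iff.1 hx
  obtain ⟨y₁, y₂, k₁, k₂, rfl⟩ := mem_graph_sub_iff.1 hy
  rw [inner_sub_left, inner_sub_right, hA _ _ _ _ h₁ k₁, hB _ _ _ _ h₂ k₂]

lemma isFormalAdjoint_smul {A A' : H →ₗ.[ℂ] H} (hA : A.IsFormalAdjoint A') (c : ℂ) :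
    (c • A).IsFormalAdjoint ((starRingEnd ℂ c) • A') := by
  rw [isFormalAdjoint_iff] at *
  intro x x' y y' hx hy
  obtain ⟨x₁, h₁, rfl⟩ := mem_graph_smul_iff.1 hx
  obtain ⟨y₁, k₁, rfl⟩ := mem_graph_smul_iff.1 hy
  rw [inner_smul_left, inner_smul_right, hA _ _ _ _ h₁ k₁]

lemma isFormalAdjoint_opMul {A A' B B' : H →ₗ.[ℂ] H} (hA : A.IsFormalAdjoint A')
    (hB : B.IsFormalAdjoint B') : (opMul A B).IsFormalAdjoint (opMul B' A') := by
  rw [isFormalAdjoint_iff] at *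
  intro x x' y y' hx hy
  obtain ⟨x₁, h₁, h₂⟩ := mem_graph_opMul_iff.1 hx
  obtain ⟨y₁, k₁, k₂⟩ := mem_graph_opMul_iff.1 hy
  rw [hA _ _ _ _ h₂ k₁, hB _ _ _ _ h₁ k₂]

lemma isFormalAdjoint_sum {ι : Type*} (s : Finset ι) {A B : ι → H →ₗ.[ℂ] H}
    (h : ∀ i ∈ s, (A i).IsFormalAdjoint (B i)) :
    (∑ i ∈ s, A i).IsFormalAdjoint (∑ i ∈ s, B i) := by
  classical
  induction s using Finset.induction_on with
  | empty =>
    rw [Finset.sum_empty, Finset.sum_empty]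
    intro x y
    simp
  | insert a s ha ih =>
    rw [Finset.sum_insert ha, Finset.sum_insert ha]
    exact isFormalAdjoint_add (h a (Finset.mem_insert_self a s))
      (ih fun i hi => h i (Finset.mem_insert_of_mem hi))

lemma isFormalAdjoint_strongLim {A B : ℕ → H →ₗ.[ℂ] H} (h : ∀ m, (A m).IsFormalAdjoint (B m)) :
    (strongLim A).IsFormalAdjoint (strongLim B) := by
  simp only [isFormalAdjoint_iff] at *
  intro x x' y y' hx hy
  obtain ⟨u, hu, tu⟩ := mem_graph_strongLim_iff.1 hx
  obtain ⟨v, hv, tv⟩ := mem_graph_strongLim_iff.1 hy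
  refine tendsto_nhds_unique (tu.inner tendsto_const_nhds) ?_
  refine (tendsto_const_nhds.inner tv).congr fun m => ?_
  exact (h (m + 1) _ _ _ _ (hu m) (hv m)).symm

/-- The symmetry relation between two graph points is a closed condition in each of them separately.
-/
lemma isFormalAdjoint_closure {A B : H →ₗ.[ℂ] H} (hA : A.IsClosable) (hB : B.IsClosable)
    (h : A.IsFormalAdjoint B) : A.closure.IsFormalAdjoint B.closure := by
  rw [isFormalAdjoint_iff] at *
  have key : ∀ p ∈ _root_.closure (A.graph : Set (H × H)),
      ∀ q ∈ _root_.closure (B.graph : Set (H × H)), ⟪p.2, q.1⟫_ℂ = ⟪p.1, q.2⟫_ℂ := by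
    intro p hp q hq
    refine closure_minimal (t := {p : H × H | ⟪p.2, q.1⟫_ℂ = ⟪p.1, q.2⟫_ℂ}) ?_
      (isClosed_eq (by fun_prop) (by fun_prop)) hp
    intro p hp
    exact closure_minimal (t := {q : H × H | ⟪p.2, q.1⟫_ℂ = ⟪p.1, q.2⟫_ℂ})
      (fun q hq => h _ _ _ _ hp hq) (isClosed_eq (by fun_prop) (by fun_prop)) hq
  intro x x' y y' hx hy
  rw [← hA.graph_closure_eq_closure_graph] at hx
  rw [← hB.graph_closure_eq_closure_graph] at hy
  exact key _ hx _ hy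

variable [CompleteSpace H]

/-- The adjoint is a closed extension. -/
lemma isClosable_of_isFormalAdjoint {A : H →ₗ.[ℂ] H} (hd : Dense (A.domain : Set H))
    (h : A.IsFormalAdjoint A) : A.IsClosable :=
  (LinearPMap.adjoint_isClosed hd).isClosable.leIsClosable (h.le_adjoint hd)

/-- A densely defined symmetric operator `A` such that `A + iμ` and `A - iμ` are surjective is
self-adjoint. -/
theorem isSelfAdjoint_of_surjective {A : H →ₗ.[ℂ] H} (hd : Dense (A.domain : Set H))
    (h : A.IsFormalAdjoint A) (μ : ℝ)
    (h₁ : ∀ z : H, ∃ x y, (x, y) ∈ A.graph ∧ y + (μ * Complex.I) • x = z)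
    (h₂ : ∀ z : H, ∃ x y, (x, y) ∈ A.graph ∧ y - (μ * Complex.I) • x = z) :
    IsSelfAdjoint A := by
  rw [LinearPMap.isSelfAdjoint_def]
  have hle : A ≤ A.adjoint := h.le_adjoint hd
  refine (LinearPMap.eq_of_le_of_domain_eq hle (le_antisymm hle.1 fun x hx => ?_)).symm
  have hf := LinearPMap.adjoint_isFormalAdjoint hd
  rw [isFormalAdjoint_iff] at hf
  obtain ⟨x', hx'⟩ : ∃ x', (x, x') ∈ A.adjoint.graph := ⟨_, mem_graph_iff_exists.2 ⟨hx, rfl⟩⟩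
  -- With this y in D(A), x - y lies in the kernel of A† + iμ. That kernel is orthogonal to the
  -- range of A - iμ, which is everything, so x = y.
  obtain ⟨y, y', hy, e⟩ := h₁ (x' + (μ * Complex.I) • x)
  have hy' : (y, y') ∈ A.adjoint.graph := LinearPMap.le_graph_of_le hle hy
  obtain ⟨w, w', hw, e'⟩ := h₂ (x - y)
  have h0 : ⟪x - y, x - y⟫_ℂ = 0 := by
    have hs : (x - y, x' - y') ∈ A.adjoint.graph := A.adjoint.graph.sub_mem hx' hy'
    have e1 := hf _ _ _ _ hs hw
    have e2 : x' - y' = -((μ * Complex.I) • (x - y)) := by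
      have e3 : x' - y' + (μ * Complex.I) • (x - y) =
          x' + (μ * Complex.I) • x - (y' + (μ * Complex.I) • y) := by module
      rw [eq_neg_iff_add_eq_zero, e3, e, sub_self]
    nth_rewrite 2 [← e']
    rw [inner_sub_right, ← e1, e2, inner_neg_left, inner_smul_left, inner_smul_right]
    simp
  have hxy : x = y := sub_eq_zero.1 (inner_self_eq_zero.1 h0)
  rw [hxy]
  exact (mem_graph_iff_exists.1 hy).fst

end Graph

/-! ### Multiplication operators, shifts and symmetry of T_f on ℓ²(ℕ) -/

section EllTwo

/-- The standard basis vectors of `ℓ²(ℕ)`. -/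
def basisVec (j : ℕ) : EllTwo := lp.single 2 j (1 : ℂ)

lemma basisVec_apply (j n : ℕ) : basisVec j n = if n = j then 1 else 0 := by
  rw [basisVec, lp.coeFn_single, Pi.single_apply]

lemma norm_basisVec (j : ℕ) : ‖basisVec j‖ = 1 := by
  rw [basisVec, lp.norm_single (by norm_num)]
  simp

lemma single_eq_smul_basisVec (j : ℕ) (c : ℂ) :
    (lp.single 2 j c : EllTwo) = c • basisVec j := by
  rw [basisVec, ← lp.single_smul, smul_eq_mul, mul_one]

lemma hasSum_smul_basisVec (φ : EllTwo) : HasSum (fun j => φ j • basisVec j) φ := by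
  simpa only [single_eq_smul_basisVec] using lp.hasSum_single (p := 2) (by norm_num) φ

lemma inner_basisVec (j : ℕ) (φ : EllTwo) : ⟪basisVec j, φ⟫_ℂ = φ j := by
  rw [basisVec, lp.inner_single_left]
  simp

lemma dense_of_basisVec_mem {D : Submodule ℂ EllTwo} (h : ∀ j, basisVec j ∈ D) :
    Dense (D : Set EllTwo) := by
  rw [Submodule.dense_iff_topologicalClosure_eq_top, Submodule.topologicalClosure_eq_top_iff,
    Submodule.eq_bot_iff]
  intro φ hφ
  ext j
  rw [← inner_basisVec, hφ _ (h j)]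
  rfl

/-- The span of the differences of consecutive basis vectors. -/
def sumZero : Submodule ℂ EllTwo :=
  Submodule.span ℂ (Set.range fun j => basisVec j - basisVec (j + 1))

/-- A vector orthogonal to all consecutive differences has constant coordinates, and a constant
sequence in ℓ² vanishes. -/
lemma dense_sumZero : Dense (sumZero : Set EllTwo) := by
  rw [Submodule.dense_iff_topologicalClosure_eq_top, Submodule.topologicalClosure_eq_top_iff,
    Submodule.eq_bot_iff]
  intro φ hφ
  have hstep : ∀ j, φ (j + 1) = φ j := by
    intro j
    have := hφ _ (Submodule.subset_span ⟨j, rfl⟩)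
    rw [inner_sub_left, inner_basisVec, inner_basisVec] at this
    exact (sub_eq_zero.1 this).symm
  have hconst : ∀ j, φ j = φ 0 := by
    intro j
    induction j with
    | zero => rfl
    | succ j ih => rw [hstep, ih]
  have hs := (memℓp_gen_iff (p := 2) (by norm_num)).1 (lp.memℓp φ)
  simp only [hconst] at hs
  have h0 := (summable_const_iff _).1 hs
  have h1 : φ 0 = 0 := by simpa using h0
  ext j
  rw [hconst j, h1]
  rfl

lemma sumZero_ne_bot : sumZero ≠ ⊥ := by
  intro h
  have h1 : basisVec 0 - basisVec (0 + 1) ∈ sumZero := Submodule.subset_span ⟨0, rfl⟩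
  rw [h, Submodule.mem_bot] at h1
  have h2 := congrArg (fun φ : EllTwo => φ 0) h1
  simp [basisVec_apply] at h2

lemma memℓp_of_norm_le {φ : EllTwo} {g : ℕ → ℂ} (C : ℝ) (h : ∀ n, ‖g n‖ ≤ C * ‖φ n‖) :
    Memℓp g 2 := by
  have hs := (memℓp_gen_iff (p := 2) (by norm_num)).1 (lp.memℓp φ)
  refine memℓp_gen (Summable.of_nonneg_of_le (fun n => by positivity) (fun n => ?_)
    (hs.mul_left (C ^ 2)))
  simp only [ENNReal.toReal_ofNat, Real.rpow_ofNat]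
  rw [← mul_pow]
  exact pow_le_pow_left₀ (norm_nonneg _) (h n) 2

lemma norm_sq_eq_tsum (φ : EllTwo) : ‖φ‖ ^ 2 = ∑' n, ‖φ n‖ ^ 2 := by
  have := lp.norm_rpow_eq_tsum (p := 2) (by norm_num) φ
  simpa using this

lemma summable_norm_sq (φ : EllTwo) : Summable fun n => ‖φ n‖ ^ 2 := by
  have hs := (memℓp_gen_iff (p := 2) (by norm_num)).1 (lp.memℓp φ)
  simpa using hs

lemma mem_graph_funN_iff {u : ℕ → ℝ} {φ ψ : EllTwo} :
    (φ, ψ) ∈ (funN u).graph ↔ ∀ n, ψ n = u n * φ n := by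
  rw [mem_graph_iff_exists]
  constructor
  · rintro ⟨h, rfl⟩ n
    rfl
  · intro h
    have e : (fun n => (u n : ℂ) * φ n) = fun n => ψ n := funext fun n => (h n).symm
    have hm : Memℓp (fun n => (u n : ℂ) * φ n) 2 := by
      rw [e]
      exact lp.memℓp ψ
    refine ⟨hm, ?_⟩
    ext n
    exact (h n).symm

lemma mem_graph_funN_basisVec (u : ℕ → ℝ) (j : ℕ) :
    (basisVec j, (u j : ℂ) • basisVec j) ∈ (funN u).graph := by
  rw [mem_graph_funN_iff]
  intro n
  rw [lp.coeFn_smul, Pi.smul_apply, smul_eq_mul, basisVec_apply]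
  split_ifs with h
  · rw [h]
  · simp

lemma basisVec_mem_domain_funN (u : ℕ → ℝ) (j : ℕ) : basisVec j ∈ (funN u).domain :=
  (mem_graph_iff_exists.1 (mem_graph_funN_basisVec u j)).fst

lemma isFormalAdjoint_funN (u : ℕ → ℝ) : (funN u).IsFormalAdjoint (funN u) := by
  rw [isFormalAdjoint_iff]
  intro x x' y y' hx hy
  rw [mem_graph_funN_iff] at hx hy
  rw [lp.inner_eq_tsum, lp.inner_eq_tsum]
  refine tsum_congr fun n => ?_
  rw [hx, hy]
  simp only [RCLike.inner_apply, map_mul, Complex.conj_ofReal]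
  ring

lemma norm_add_mul_I_ge (a μ : ℝ) : |μ| ≤ ‖(a : ℂ) + μ * Complex.I‖ ∧
    |a| ≤ ‖(a : ℂ) + μ * Complex.I‖ := by
  have h1 := Complex.abs_im_le_norm ((a : ℂ) + μ * Complex.I)
  have h2 := Complex.abs_re_le_norm ((a : ℂ) + μ * Complex.I)
  simp at h1 h2
  exact ⟨h1, h2⟩

lemma funN_add_surjective (u : ℕ → ℝ) {μ : ℝ} (hμ : μ ≠ 0) (z : EllTwo) :
    ∃ x y, (x, y) ∈ (funN u).graph ∧ y + (μ * Complex.I) • x = z := by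
  have hd : ∀ n, (u n : ℂ) + μ * Complex.I ≠ 0 := fun n h0 => by
    have := (norm_add_mul_I_ge (u n) μ).1
    rw [h0, norm_zero] at this
    exact hμ (abs_nonpos_iff.1 this)
  have hx : Memℓp (fun n => z n / ((u n : ℂ) + μ * Complex.I)) 2 := by
    refine memℓp_of_norm_le (φ := z) |μ|⁻¹ fun n => ?_
    rw [norm_div, div_eq_inv_mul]
    exact mul_le_mul_of_nonneg_right
      (inv_anti₀ (abs_pos.2 hμ) (norm_add_mul_I_ge (u n) μ).1) (norm_nonneg _)
  refine ⟨⟨_, hx⟩, z - (μ * Complex.I) • ⟨_, hx⟩, ?_, by abel⟩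
  rw [mem_graph_funN_iff]
  intro n
  change z n - (μ * Complex.I) * (z n / ((u n : ℂ) + μ * Complex.I)) =
    u n * (z n / ((u n : ℂ) + μ * Complex.I))
  have := hd n
  field_simp
  ring

theorem isSelfAdjoint_funN (u : ℕ → ℝ) : IsSelfAdjoint (funN u) := by
  refine isSelfAdjoint_of_surjective (dense_of_basisVec_mem (basisVec_mem_domain_funN u))
    (isFormalAdjoint_funN u) 1 (funN_add_surjective u one_ne_zero) fun z => ?_
  obtain ⟨x, y, hxy, e⟩ := funN_add_surjective u (neg_ne_zero.2 one_ne_zero) z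
  refine ⟨x, y, hxy, ?_⟩
  rw [← e]
  push_cast
  module

/-- `LinearPMap.inverse` has the swapped graph only when the kernel is trivial, which the
nonvanishing of u ensures. -/
lemma funN_inverse {u : ℕ → ℝ} (hu : ∀ n, u n ≠ 0) :
    (funN u).inverse = funN fun n => (u n)⁻¹ := by
  have hker : LinearMap.ker (funN u).toFun = ⊥ := by
    rw [LinearMap.ker_eq_bot']
    rintro ⟨φ, hφ⟩ h
    have h' : funN u ⟨φ, hφ⟩ = 0 := h
    have hg := mem_graph_funN_iff.1 (mem_graph_iff_exists.2 ⟨hφ, h'⟩)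
    refine Subtype.ext ?_
    ext n
    have hn := hg n
    have hun : (u n : ℂ) ≠ 0 := Complex.ofReal_ne_zero.2 (hu n)
    rcases mul_eq_zero.1 hn.symm with h0 | h0
    · exact absurd h0 hun
    · exact h0
  refine LinearPMap.eq_of_eq_graph (Submodule.ext fun p => ?_)
  obtain ⟨φ, ψ⟩ := p
  rw [LinearPMap.inverse_graph hker, mem_graph_funN_iff]
  constructor
  · rintro ⟨⟨a, b⟩, hab, e⟩
    simp only [LinearEquiv.coe_coe, LinearEquiv.prodComm_apply, Prod.swap_prod_mk,
      Prod.mk.injEq] at e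
    obtain ⟨rfl, rfl⟩ := e
    intro n
    have hun : (u n : ℂ) ≠ 0 := Complex.ofReal_ne_zero.2 (hu n)
    rw [mem_graph_funN_iff.1 hab n]
    push_cast
    field_simp
  · intro h
    refine ⟨(ψ, φ), mem_graph_funN_iff.2 fun n => ?_, rfl⟩
    have hun : (u n : ℂ) ≠ 0 := Complex.ofReal_ne_zero.2 (hu n)
    rw [h n]
    push_cast
    field_simp

lemma mem_graph_ofBounded (B : EllTwo →L[ℂ] EllTwo) (φ : EllTwo) :
    (φ, B φ) ∈ (ofBounded B).graph :=
  mem_graph_iff_exists.2 ⟨Submodule.mem_top, rfl⟩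

lemma isFormalAdjoint_ofBounded (B : EllTwo →L[ℂ] EllTwo) :
    (ofBounded (ContinuousLinearMap.adjoint B)).IsFormalAdjoint (ofBounded B) := fun x y =>
  ContinuousLinearMap.adjoint_inner_left B (y : EllTwo) (x : EllTwo)

lemma leftShift_pow_apply (k : ℕ) (φ : EllTwo) (n : ℕ) : (leftShift ^ k) φ n = φ (n + k) := by
  induction k generalizing n with
  | zero => rfl
  | succ k ih =>
    rw [pow_succ', mul_apply_eq_comp]
    change (leftShift ^ k) φ (n + 1) = _
    rw [ih, show n + 1 + k = n + (k + 1) by omega]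

lemma adjoint_leftShift_pow (k : ℕ) : ContinuousLinearMap.adjoint leftShift ^ k =
    ContinuousLinearMap.adjoint (leftShift ^ k) := by
  simp only [← ContinuousLinearMap.star_eq_adjoint, star_pow]

lemma adjoint_leftShift_pow_basisVec (k j : ℕ) :
    (ContinuousLinearMap.adjoint leftShift ^ k) (basisVec j) = basisVec (j + k) := by
  rw [adjoint_leftShift_pow]
  ext n
  rw [← inner_basisVec, ContinuousLinearMap.adjoint_inner_right, ← inner_conj_symm,
    inner_basisVec, leftShift_pow_apply, basisVec_apply, basisVec_apply]
  simp only [eq_comm]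
  split_ifs <;> simp

lemma delta_ne_zero {f : ℕ → ℝ} (hf : StrictMono f) {k : ℕ} (hk : 1 ≤ k) (n : ℕ) :
    delta k f n ≠ 0 :=
  (sub_pos.2 (hf (by omega : n < n + k))).ne'

/-- Each summand is a difference of two mutually formally adjoint operators, so taking the adjoint
swaps them; the resulting sign is absorbed by conj(i) = -i. -/
lemma isFormalAdjoint_timeOpTrunc {f : ℕ → ℝ} (hf : StrictMono f) (m : ℕ) :
    (timeOpTrunc f m).IsFormalAdjoint (timeOpTrunc f m) := by
  have h1 : ∀ k ∈ Finset.Icc 1 m,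
      (opMul (ofBounded (ContinuousLinearMap.adjoint leftShift ^ k)) (funN (delta k f)).inverse
        - opMul (funN (delta k f)).inverse (ofBounded (leftShift ^ k))).IsFormalAdjoint
      (opMul (funN (delta k f)).inverse (ofBounded (leftShift ^ k))
        - opMul (ofBounded (ContinuousLinearMap.adjoint leftShift ^ k))
          (funN (delta k f)).inverse) := by
    intro k hk
    have hk' := (Finset.mem_Icc.1 hk).1
    rw [funN_inverse (delta_ne_zero hf hk'), adjoint_leftShift_pow]
    have h := isFormalAdjoint_opMul (isFormalAdjoint_ofBounded (leftShift ^ k))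
      (isFormalAdjoint_funN fun n => (delta k f n)⁻¹)
    exact isFormalAdjoint_sub h h.symm
  have h2 := isFormalAdjoint_smul (isFormalAdjoint_sum _ h1) Complex.I
  rw [isFormalAdjoint_iff] at h2 ⊢
  intro x x' y y' hx hy
  refine h2 x x' y y' hx ?_
  obtain ⟨z, hz, rfl⟩ := mem_graph_smul_iff.1 hy
  refine mem_graph_smul_iff.2 ⟨-z, ?_, by simp⟩
  have hneg : ∀ s : Finset ℕ, ∀ A B : ℕ → EllTwo →ₗ.[ℂ] EllTwo, ∀ y z,
      (y, z) ∈ (∑ k ∈ s, (A k - B k)).graph → (y, -z) ∈ (∑ k ∈ s, (B k - A k)).graph := by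
    intro s A B
    induction s using Finset.induction_on with
    | empty =>
      intro y z h
      rw [Finset.sum_empty] at h ⊢
      obtain ⟨h0, rfl⟩ := mem_graph_iff_exists.1 h
      exact mem_graph_iff_exists.2 ⟨h0, by simp⟩
    | insert a s ha ih =>
      intro y z h
      rw [Finset.sum_insert ha] at h ⊢
      obtain ⟨z₁, z₂, h₁, h₂, rfl⟩ := mem_graph_add_iff.1 h
      obtain ⟨w₁, w₂, k₁, k₂, rfl⟩ := mem_graph_sub_iff.1 h₁
      exact mem_graph_add_iff.2 ⟨_, _, mem_graph_sub_iff.2 ⟨_, _, k₂, k₁, rfl⟩, ih _ _ h₂,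
        by abel⟩
  exact hneg _ _ _ _ _ hz

lemma isFormalAdjoint_timeOp {f : ℕ → ℝ} (hf : StrictMono f) :
    (timeOp f).IsFormalAdjoint (timeOp f) :=
  isFormalAdjoint_strongLim (isFormalAdjoint_timeOpTrunc hf)

end EllTwo

/-! ### Self-adjointness after adding γ f(N)² -/

section Perturbation

/-- A square-summable family of vectors of square sum `< 1` is the family of columns of a strict
contraction of `ℓ²(ℕ)`. -/
lemma exists_contraction_of_columns {w : ℕ → EllTwo} (hw : Summable fun j => ‖w j‖ ^ 2)
    (h1 : ∑' j, ‖w j‖ ^ 2 < 1) :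
    ∃ B : EllTwo →L[ℂ] EllTwo, ‖B‖ < 1 ∧ ∀ φ : EllTwo, HasSum (fun j => φ j • w j) (B φ) := by
  set S := ∑' j, ‖w j‖ ^ 2 with hS
  have hS0 : 0 ≤ S := tsum_nonneg fun j => by positivity
  have key : ∀ φ : EllTwo, Summable (fun j => ‖φ j • w j‖) ∧
      ∑' j, ‖φ j • w j‖ ≤ √S * ‖φ‖ := by
    intro φ
    -- Cauchy–Schwarz gives absolute convergence and the operator bound √S at once.
    have h2 := Real.summable_and_inner_le_Lp_mul_Lq_tsum_of_nonneg (p := 2) (q := 2)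
      Real.HolderConjugate.two_two (f := fun j => ‖φ j‖) (g := fun j => ‖w j‖)
      (fun _ => norm_nonneg _) (fun _ => norm_nonneg _)
      (by simpa using summable_norm_sq φ) (by simpa using hw)
    simp only [norm_smul]
    refine ⟨h2.1, h2.2.trans_eq ?_⟩
    simp only [Real.rpow_ofNat, ← Real.sqrt_eq_rpow]
    rw [← norm_sq_eq_tsum, Real.sqrt_sq (norm_nonneg _), mul_comm]
  have hsum : ∀ φ : EllTwo, Summable fun j => φ j • w j := fun φ => (key φ).1.of_norm
  refine ⟨LinearMap.mkContinuous
    { toFun := fun φ => ∑' j, φ j • w j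
      map_add' := fun φ ψ => by
        rw [← (hsum φ).tsum_add (hsum ψ)]
        exact tsum_congr fun j => add_smul _ _ _
      map_smul' := fun c φ => by
        rw [RingHom.id_apply, ← tsum_const_smul'']
        exact tsum_congr fun j => mul_smul _ _ _ } (√S)
    (fun φ => (norm_tsum_le_tsum_norm (key φ).1).trans (key φ).2), ?_, fun φ => (hsum φ).hasSum⟩
  refine (LinearMap.mkContinuous_norm_le _ (Real.sqrt_nonneg S) _).trans_lt ?_
  rw [Real.sqrt_lt' one_pos]
  simpa using h1

/-- Each term tends to 0 as μ grows, and a/b is a summable majorant: dominated convergence. -/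
lemma exists_tsum_div_lt_one {a b : ℕ → ℝ} (ha : ∀ j, 0 ≤ a j) (hb : ∀ j, 0 < b j)
    (hs : Summable fun j => a j / b j) :
    ∃ μ : ℝ, 0 < μ ∧ ∑' j, a j / (b j + μ ^ 2) < 1 := by
  have hlim : Tendsto (fun μ : ℝ => ∑' j, a j / (b j + μ ^ 2)) atTop (𝓝 (∑' _ : ℕ, (0 : ℝ))) := by
    refine tendsto_tsum_of_dominated_convergence hs (fun j => ?_) (Eventually.of_forall fun μ j => ?_)
    · exact tendsto_const_nhds.div_atTop
        (tendsto_atTop_add_const_left _ _ (tendsto_pow_atTop two_ne_zero))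
    · have := ha j
      have := hb j
      rw [Real.norm_of_nonneg (by positivity)]
      gcongr
      nlinarith [sq_nonneg μ]
  rw [tsum_zero] at hlim
  obtain ⟨μ, h1, h2⟩ := ((hlim.eventually_lt_const one_pos).and (eventually_gt_atTop 0)).exists
  exact ⟨μ, h2, h1⟩

variable {A : EllTwo →ₗ.[ℂ] EllTwo} {v : ℕ → EllTwo} {f : ℕ → ℝ} {γ : ℝ}

lemma basisVec_mem_graph_add_sq (hv : ∀ j, (basisVec j, v j) ∈ A.graph) (γ : ℝ) (j : ℕ) :
    (basisVec j, v j + (γ * (f j : ℂ) ^ 2) • basisVec j) ∈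
      (A + (γ : ℂ) • opMul (funN f) (funN f)).graph := by
  have h := (funN f).graph.smul_mem (f j : ℂ) (mem_graph_funN_basisVec f j)
  refine mem_graph_add_iff.2 ⟨_, _, hv j, mem_graph_smul_iff.2
    ⟨_, mem_graph_opMul_iff.2 ⟨_, mem_graph_funN_basisVec f j, h⟩, rfl⟩, ?_⟩
  simp only [smul_smul]
  congr 2
  ring

/-- Substituting x = d⁻¹χ, with d the diagonal of γ f(N)² + iμ, reduces the equation to (1 + B)χ = z
for a strict contraction B. -/
lemma add_sq_surjective (hcl : A.IsClosed) (hv : ∀ j, (basisVec j, v j) ∈ A.graph)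
    (hf : ∀ n, 1 ≤ f n) (hγ : γ ≠ 0) {μ : ℝ}
    (hs : Summable fun j => ‖v j‖ ^ 2 / (γ ^ 2 * f j ^ 4 + μ ^ 2))
    (h1 : ∑' j, ‖v j‖ ^ 2 / (γ ^ 2 * f j ^ 4 + μ ^ 2) < 1) (z : EllTwo) :
    ∃ x y, (x, y) ∈ (A + (γ : ℂ) • opMul (funN f) (funN f)).graph ∧
      y + (μ * Complex.I) • x = z := by
  set d : ℕ → ℂ := fun j => ((γ * f j ^ 2 : ℝ) : ℂ) + μ * Complex.I with hd
  have hfpos : ∀ j, 0 < f j := fun j => one_pos.trans_le (hf j)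
  have hdn : ∀ j, |γ| * f j ^ 2 ≤ ‖d j‖ := fun j => by
    have := (norm_add_mul_I_ge (γ * f j ^ 2) μ).2
    rwa [abs_mul, abs_of_nonneg (sq_nonneg (f j))] at this
  have hγ' : 0 < |γ| := abs_pos.2 hγ
  have hdpos : ∀ j, 0 < ‖d j‖ := fun j =>
    (mul_pos hγ' (pow_pos (hfpos j) 2)).trans_le (hdn j)
  have hd0 : ∀ j, d j ≠ 0 := fun j => norm_pos_iff.1 (hdpos j)
  have hdsq : ∀ j, ‖d j‖ ^ 2 = γ ^ 2 * f j ^ 4 + μ ^ 2 := fun j => by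
    rw [← Complex.normSq_eq_norm_sq, hd, Complex.normSq_add_mul_I]
    ring
  have hw : ∀ j, ‖(d j)⁻¹ • v j‖ ^ 2 = ‖v j‖ ^ 2 / (γ ^ 2 * f j ^ 4 + μ ^ 2) := fun j => by
    rw [norm_smul, norm_inv, mul_pow, inv_pow, hdsq, div_eq_inv_mul]
  obtain ⟨B, hB, hBs⟩ := exists_contraction_of_columns (w := fun j => (d j)⁻¹ • v j)
    (by simpa only [hw] using hs) (by simpa only [hw] using h1)
  obtain ⟨χ, hχ⟩ : ∃ χ : EllTwo, χ + B χ = z := by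
    obtain ⟨u, hu⟩ := isUnit_one_sub_of_norm_lt_one (x := -B) (by rwa [norm_neg])
    refine ⟨(↑u⁻¹ : EllTwo →L[ℂ] EllTwo) z, ?_⟩
    have h2 : (u : EllTwo →L[ℂ] EllTwo) ((↑u⁻¹ : EllTwo →L[ℂ] EllTwo) z) = z := by
      rw [← mul_apply_eq_comp, Units.mul_inv]
      rfl
    rw [hu] at h2
    simpa using h2
  -- Applied with c = 1, f and f², this puts x, f x and f² x in ℓ², using |γ| f² ≤ |d| and f ≥ 1.
  have hmem : ∀ c : ℕ → ℂ, (∀ j, ‖c j‖ ≤ f j ^ 2) → Memℓp (fun j => c j * ((d j)⁻¹ * χ j)) 2 :=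
    fun c hc => memℓp_of_norm_le (φ := χ) |γ|⁻¹ fun j => by
      rw [← mul_assoc, norm_mul, norm_mul, norm_inv]
      refine mul_le_mul_of_nonneg_right ?_ (norm_nonneg _)
      rw [← div_eq_mul_inv, div_le_iff₀ (hdpos j)]
      calc ‖c j‖ ≤ f j ^ 2 := hc j
        _ = |γ|⁻¹ * (|γ| * f j ^ 2) := by field_simp
        _ ≤ |γ|⁻¹ * ‖d j‖ := by gcongr; exact hdn j
  have hx0 := hmem (fun _ => 1) fun j => by
    rw [norm_one]
    exact one_le_pow₀ (hf j)
  have hx1 := hmem (fun j => f j) fun j => by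
    rw [Complex.norm_real, Real.norm_of_nonneg (hfpos j).le]
    nlinarith [hf j]
  have hx2 := hmem (fun j => f j * f j) fun j => by
    rw [norm_mul, Complex.norm_real, Real.norm_of_nonneg (hfpos j).le, sq]
  set x : EllTwo := ⟨_, hx0⟩ with hx
  have hxa : ∀ j, x j = (d j)⁻¹ * χ j := fun j => one_mul _
  -- The partial sums of ∑ x_j (e_j, v_j) lie in the graph and converge to (x, Bχ); closedness of A
  -- is what makes the limit admissible.
  have hA : (x, B χ) ∈ A.graph := by
    have hcl' : IsClosed (A.graph : Set (EllTwo × EllTwo)) := hcl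
    refine hcl'.mem_of_tendsto ((hasSum_smul_basisVec x).prodMk_nhds (hBs χ)) ?_
    refine Eventually.of_forall fun s => ?_
    have : ∑ j ∈ s, x j • (basisVec j, v j) ∈ A.graph :=
      Submodule.sum_mem _ fun j _ => A.graph.smul_mem _ (hv j)
    refine (congrArg (· ∈ A.graph) ?_).mp this
    refine Prod.ext ?_ ?_
    · simp [Prod.fst_sum]
    · simp only [Prod.snd_sum, Prod.smul_snd]
      refine Finset.sum_congr rfl fun j _ => ?_
      rw [hxa, smul_smul, mul_comm]
  have hH1 : (x, (⟨_, hx1⟩ : EllTwo)) ∈ (funN f).graph :=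
    mem_graph_funN_iff.2 fun n => congrArg ((f n : ℂ) * ·) (hxa n).symm
  have hH2 : ((⟨_, hx1⟩ : EllTwo), (⟨_, hx2⟩ : EllTwo)) ∈ (funN f).graph :=
    mem_graph_funN_iff.2 fun n => mul_assoc _ _ _
  refine ⟨x, _, mem_graph_add_iff.2 ⟨_, _, hA, mem_graph_smul_iff.2
    ⟨_, mem_graph_opMul_iff.2 ⟨_, hH1, hH2⟩, rfl⟩, rfl⟩, ?_⟩
  rw [← hχ, add_comm χ, add_assoc]
  congr 1
  ext j
  change γ * (f j * f j * ((d j)⁻¹ * χ j)) + μ * Complex.I * (x j) = χ j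
  rw [hxa]
  have h3 : γ * (f j * f j * ((d j)⁻¹ * χ j)) + μ * Complex.I * ((d j)⁻¹ * χ j) =
      d j * (d j)⁻¹ * χ j := by
    simp only [hd]
    push_cast
    ring
  rw [h3, mul_inv_cancel₀ (hd0 j), one_mul]

/-- Let `A` be a closed symmetric operator defined on the standard basis, with
`∑ ‖A eⱼ‖² / f(j)⁴ < ∞`. Then `A + γ f(N)²` is self-adjoint for every real `γ ≠ 0`. -/
theorem isSelfAdjoint_add_sq (hcl : A.IsClosed) (hA : A.IsFormalAdjoint A)
    (hv : ∀ j, (basisVec j, v j) ∈ A.graph) (hf : ∀ n, 1 ≤ f n)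
    (hs : Summable fun j => ‖v j‖ ^ 2 / f j ^ 4) (hγ : γ ≠ 0) :
    IsSelfAdjoint (A + (γ : ℂ) • opMul (funN f) (funN f)) := by
  have hb : ∀ j, 0 < γ ^ 2 * f j ^ 4 := fun j => by
    have := one_pos.trans_le (hf j)
    positivity
  have hs' : Summable fun j => ‖v j‖ ^ 2 / (γ ^ 2 * f j ^ 4) := by
    refine (hs.mul_left (γ ^ 2)⁻¹).congr fun j => ?_
    rw [← div_eq_inv_mul, div_div, mul_comm (f j ^ 4)]
  obtain ⟨μ, hμ, h1⟩ := exists_tsum_div_lt_one (fun j => sq_nonneg ‖v j‖) hb hs'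
  have hs'' : Summable fun j => ‖v j‖ ^ 2 / (γ ^ 2 * f j ^ 4 + μ ^ 2) := by
    refine hs'.of_nonneg_of_le (fun j => ?_) fun j => ?_
    · have := hb j
      positivity
    · exact div_le_div_of_nonneg_left (sq_nonneg _) (hb j) (by nlinarith [sq_nonneg μ])
  have hd : Dense ((A + (γ : ℂ) • opMul (funN f) (funN f)).domain : Set EllTwo) :=
    dense_of_basisVec_mem fun j =>
      (mem_graph_iff_exists.1 (basisVec_mem_graph_add_sq hv γ j)).fst
  have hsym := isFormalAdjoint_smul
    (isFormalAdjoint_opMul (isFormalAdjoint_funN f) (isFormalAdjoint_funN f)) (γ : ℂ)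
  rw [Complex.conj_ofReal] at hsym
  refine isSelfAdjoint_of_surjective hd (isFormalAdjoint_add hA hsym) μ
    (add_sq_surjective hcl hv hf hγ hs'' h1) fun z => ?_
  obtain ⟨x, y, hxy, e⟩ := add_sq_surjective (μ := -μ) hcl hv hf hγ
    (by simpa only [neg_sq] using hs'') (by simpa only [neg_sq] using h1) z
  refine ⟨x, y, hxy, ?_⟩
  rw [← e]
  push_cast
  module

end Perturbation

/-! ### The matrix of T_f: closability, unboundedness and the CCR -/

section Columns

/-- The square-summability of the columns of the matrix `(f(n) - f(j))⁻¹`, `n ≠ j`. -/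
def ColumnsSummable (f : ℕ → ℝ) : Prop := ∀ j, Summable fun n => ((f n - f j)⁻¹) ^ 2

variable {f : ℕ → ℝ}

lemma norm_I_mul_ofReal_sq (r : ℝ) : ‖Complex.I * (r : ℂ)‖ ^ 2 = r ^ 2 := by
  rw [norm_mul, Complex.norm_I, one_mul, Complex.norm_real, Real.norm_eq_abs, sq_abs]

/-- The column `n ↦ i / (f(n) - f(j))` (and `0` for `n = j`). -/
def column (hc : ColumnsSummable f) (j : ℕ) : EllTwo :=
  ⟨fun n => Complex.I * ((f n - f j)⁻¹ : ℝ), memℓp_gen <| by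
    simpa only [ENNReal.toReal_ofNat, Real.rpow_ofNat, norm_I_mul_ofReal_sq] using hc j⟩

lemma column_apply (hc : ColumnsSummable f) (j n : ℕ) :
    column hc j n = Complex.I * ((f n - f j)⁻¹ : ℝ) := rfl

lemma norm_column_sq (hc : ColumnsSummable f) (j : ℕ) :
    ‖column hc j‖ ^ 2 = ∑' n, ((f n - f j)⁻¹) ^ 2 := by
  rw [norm_sq_eq_tsum]
  simp only [column_apply, norm_I_mul_ofReal_sq]

/-- The terms with (L*)^k produce the rows j + k and those with L^k the rows j - k, so truncation at
m keeps the entries of column j within distance m of the diagonal. -/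
lemma mem_graph_timeOpTrunc (hf : StrictMono f) (hc : ColumnsSummable f) (m j : ℕ) :
    (basisVec j, ∑ n ∈ Finset.Icc (j - m) (j + m), column hc j n • basisVec n) ∈
      (timeOpTrunc f m).graph := by
  have hL : ∀ k, (basisVec j, (((delta k f j)⁻¹ : ℝ) : ℂ) • basisVec (j + k)) ∈
      (opMul (ofBounded (ContinuousLinearMap.adjoint leftShift ^ k))
        (funN fun n => (delta k f n)⁻¹)).graph := fun k => by
    refine mem_graph_opMul_iff.2 ⟨_, mem_graph_funN_basisVec _ j, ?_⟩
    rw [← adjoint_leftShift_pow_basisVec, ← map_smul]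
    exact mem_graph_ofBounded _ _
  have hR : ∀ k, (basisVec j,
      if k ≤ j then (((delta k f (j - k))⁻¹ : ℝ) : ℂ) • basisVec (j - k) else 0) ∈
      (opMul (funN fun n => (delta k f n)⁻¹) (ofBounded (leftShift ^ k))).graph := fun k => by
    refine mem_graph_opMul_iff.2 ⟨_, mem_graph_ofBounded _ _, ?_⟩
    split_ifs with h
    · have e : (leftShift ^ k) (basisVec j) = basisVec (j - k) := by
        ext n
        rw [leftShift_pow_apply, basisVec_apply, basisVec_apply]
        exact if_congr (by omega) rfl rfl
      rw [e]
      exact mem_graph_funN_basisVec _ _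
    · have e : (leftShift ^ k) (basisVec j) = 0 := by
        ext n
        rw [leftShift_pow_apply, basisVec_apply, if_neg (by omega)]
        rfl
      rw [e]
      exact Submodule.zero_mem _
  refine mem_graph_smul_iff.2 ⟨_, mem_graph_sum (Finset.Icc 1 m) (y := fun k =>
    (((delta k f j)⁻¹ : ℝ) : ℂ) • basisVec (j + k) -
      if k ≤ j then (((delta k f (j - k))⁻¹ : ℝ) : ℂ) • basisVec (j - k) else 0)
    fun k hk => ?_, ?_⟩
  · rw [funN_inverse (delta_ne_zero hf (Finset.mem_Icc.1 hk).1)]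
    exact mem_graph_sub_iff.2 ⟨_, _, hL k, hR k, rfl⟩
  -- Truncated subtraction starts the window at 0 when m > j; this matches L^k e_j = 0 for k > j,
  -- hence the filter.
  · have hsplit : Finset.Icc (j - m) (j + m) =
        (Finset.Icc 1 m).image (fun k => j + k) ∪
          (((Finset.Icc 1 m).filter (· ≤ j)).image (fun k => j - k) ∪ {j}) := by
      ext n
      simp only [Finset.mem_Icc, Finset.mem_union, Finset.mem_image, Finset.mem_filter,
        Finset.mem_singleton]
      constructor
      · intro h
        rcases lt_trichotomy n j with h1 | h1 | h1
        · exact Or.inr (Or.inl ⟨j - n, by omega, by omega⟩)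
        · exact Or.inr (Or.inr h1)
        · exact Or.inl ⟨n - j, by omega, by omega⟩
      · rintro (⟨k, h1, rfl⟩ | ⟨k, h1, rfl⟩ | rfl) <;> omega
    rw [hsplit, Finset.sum_union, Finset.sum_union, Finset.sum_image, Finset.sum_image,
      Finset.sum_filter, Finset.sum_singleton, Finset.sum_sub_distrib, smul_sub, Finset.smul_sum,
      Finset.smul_sum, sub_eq_add_neg, ← Finset.sum_neg_distrib]
    -- The convention `0⁻¹ = 0` supplies the zero diagonal.
    · have hjj : column hc j j = 0 := by simp [column_apply]
      rw [hjj, zero_smul, add_zero]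
      congr 1
      · refine Finset.sum_congr rfl fun k _ => ?_
        rw [smul_smul, column_apply, delta]
      · refine Finset.sum_congr rfl fun k _ => ?_
        split_ifs with h
        · rw [smul_smul, column_apply, delta, Nat.sub_add_cancel h, ← neg_smul, ← neg_sub (f j),
            inv_neg]
          push_cast
          congr 1
          ring
        · simp
    · intro a ha b hb hab
      simp only [Finset.coe_filter, Finset.mem_Icc, Set.mem_ofPred_eq] at ha hb hab
      omega
    · intro a _ b _ hab
      simpa using hab
    · rw [Finset.disjoint_singleton_right]
      simp only [Finset.mem_image, Finset.mem_filter, Finset.mem_Icc]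
      rintro ⟨k, h1, h2⟩
      omega
    · rw [Finset.disjoint_left]
      simp only [Finset.mem_union, Finset.mem_image, Finset.mem_filter, Finset.mem_Icc,
        Finset.mem_singleton]
      rintro n ⟨k, h1, rfl⟩ (⟨k', h2, h3⟩ | h3) <;> omega

/-- The windows increase to ℕ, so the truncations are partial sums of the basis expansion of the
column. -/
lemma mem_graph_timeOp (hf : StrictMono f) (hc : ColumnsSummable f) (j : ℕ) :
    (basisVec j, column hc j) ∈ (timeOp f).graph := by
  refine mem_graph_strongLim_iff.2 ⟨_, fun m => mem_graph_timeOpTrunc hf hc (m + 1) j, ?_⟩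
  refine (hasSum_smul_basisVec (column hc j)).comp (tendsto_atTop_finset_of_monotone ?_ ?_)
  · intro a b hab
    exact Finset.Icc_subset_Icc (by omega) (by omega)
  · intro n
    exact ⟨n + j, by simp; omega⟩

lemma dense_domain_timeOp (hf : StrictMono f) (hc : ColumnsSummable f) :
    Dense ((timeOp f).domain : Set EllTwo) :=
  dense_of_basisVec_mem fun j => (mem_graph_iff_exists.1 (mem_graph_timeOp hf hc j)).fst

lemma isClosable_timeOp (hf : StrictMono f) (hc : ColumnsSummable f) :
    (timeOp f).IsClosable :=
  isClosable_of_isFormalAdjoint (dense_domain_timeOp hf hc) (isFormalAdjoint_timeOp hf)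

lemma mem_graph_closure_timeOp (hf : StrictMono f) (hc : ColumnsSummable f) (j : ℕ) :
    (basisVec j, column hc j) ∈ (timeOp f).closure.graph :=
  LinearPMap.le_graph_of_le (timeOp f).le_closure (mem_graph_timeOp hf hc j)

/-- The norm of column j dominates its entry in row j + 1, the reciprocal of a gap that tends to 0.
-/
lemma isUnbounded_timeOp (hf : StrictMono f) (hc : ColumnsSummable f)
    (h : Tendsto (fun j => f (j + 1) - f j) atTop (𝓝 0)) : IsUnbounded (timeOp f) := by
  rintro ⟨C, hC⟩
  have hbound : ∀ j, (f (j + 1) - f j)⁻¹ ≤ C := fun j => by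
    obtain ⟨hj, e⟩ := mem_graph_iff_exists.1 (mem_graph_timeOp hf hc j)
    have h1 := hC ⟨_, hj⟩
    rw [e, norm_basisVec, mul_one] at h1
    refine le_trans ?_ ((lp.norm_apply_le_norm two_ne_zero (column hc j) (j + 1)).trans h1)
    rw [column_apply, norm_mul, Complex.norm_I, one_mul, Complex.norm_real]
    exact Real.le_norm_self _
  have hinf : Tendsto (fun j => (f (j + 1) - f j)⁻¹) atTop atTop :=
    (tendsto_nhdsWithin_iff.2
      ⟨h, Eventually.of_forall fun j => sub_pos.2 (hf (Nat.lt_succ_self j))⟩).inv_tendsto_nhdsGT_zero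
  obtain ⟨j, hj⟩ := (hinf.eventually_gt_atTop C).exists
  exact (hbound j).not_gt hj

/-- The canonical commutation relation holds on the span of the differences of consecutive basis
vectors. -/
lemma isCCRDomain_sumZero (hf : StrictMono f) (hc : ColumnsSummable f) {A : EllTwo →ₗ.[ℂ] EllTwo}
    (hv : ∀ j, (basisVec j, column hc j) ∈ A.graph) (γ : ℝ) :
    IsCCRDomain (funN f) (A + (γ : ℂ) • opMul (funN f) (funN f)) sumZero := by
  refine ⟨sumZero_ne_bot, ?_⟩
  set T := A + (γ : ℂ) • opMul (funN f) (funN f) with hT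
  set K := opMul (funN f) T - opMul T (funN f) with hK
  -- As an inclusion of subspaces, the relation need only be checked on the spanning differences.
  suffices h : sumZero ≤ K.graph.comap (LinearMap.prod LinearMap.id (-Complex.I • LinearMap.id)) by
    intro φ hφ
    have h1 := h hφ
    simp only [Submodule.mem_comap, LinearMap.prod_apply, neg_smul] at h1
    exact mem_graph_iff_exists.1 h1
  refine Submodule.span_le.2 ?_
  rintro _ ⟨a, rfl⟩
  have hTj := fun j => basisVec_mem_graph_add_sq (f := f) hv γ j
  have hHj := fun j => mem_graph_funN_basisVec f j
  set t : ℕ → EllTwo := fun j => column hc j + (γ * (f j : ℂ) ^ 2) • basisVec j with ht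
  have hTφ := T.graph.sub_mem (hTj a) (hTj (a + 1))
  have hHφ := (funN f).graph.sub_mem (hHj a) (hHj (a + 1))
  have hTH := T.graph.sub_mem (T.graph.smul_mem (f a : ℂ) (hTj a))
    (T.graph.smul_mem (f (a + 1) : ℂ) (hTj (a + 1)))
  -- A single column is not in D(f(N)), since f(n)/(f(n) - f(j)) tends to 1. Writing this ratio as 1
  -- + f(j)/(f(n) - f(j)), the ones cancel in the difference, except in rows a and a + 1, where the
  -- missing diagonal entry leaves the term with -i.
  have hHT : (t a - t (a + 1), (f a : ℂ) • t a - (f (a + 1) : ℂ) • t (a + 1) -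
      Complex.I • (basisVec a - basisVec (a + 1))) ∈ (funN f).graph := by
    rw [mem_graph_funN_iff]
    intro n
    have hne : f a ≠ f (a + 1) := (hf (Nat.lt_succ_self a)).ne
    simp only [ht, lp.coeFn_sub, lp.coeFn_add, lp.coeFn_smul, Pi.sub_apply, Pi.add_apply,
      Pi.smul_apply, smul_eq_mul, column_apply, basisVec_apply]
    rcases eq_or_ne n a with rfl | h1
    · have h2 : (f n : ℂ) - f (n + 1) ≠ 0 := by
        rw [← Complex.ofReal_sub]
        exact Complex.ofReal_ne_zero.2 (sub_ne_zero.2 hne)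
      simp
      field_simp
      ring
    · rcases eq_or_ne n (a + 1) with rfl | h2
      · have h2 : (f (a + 1) : ℂ) - f a ≠ 0 := by
          rw [← Complex.ofReal_sub]
          exact Complex.ofReal_ne_zero.2 (sub_ne_zero.2 hne.symm)
        simp
        field_simp
        ring
      · have h3 : (f n : ℂ) - f a ≠ 0 := by
          rw [← Complex.ofReal_sub]
          exact Complex.ofReal_ne_zero.2 (sub_ne_zero.2 (hf.injective.ne h1))
        have h4 : (f n : ℂ) - f (a + 1) ≠ 0 := by
          rw [← Complex.ofReal_sub]
          exact Complex.ofReal_ne_zero.2 (sub_ne_zero.2 (hf.injective.ne h2))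
        simp only [if_neg h1, if_neg h2]
        push_cast
        field_simp
        ring
  refine mem_graph_sub_iff.2 ⟨_, _, mem_graph_opMul_iff.2 ⟨_, hTφ, hHT⟩,
    mem_graph_opMul_iff.2 ⟨_, hHφ, hTH⟩, ?_⟩
  simp only [ht, Prod.smul_mk, LinearMap.smul_apply, LinearMap.id_apply]
  module

theorem timeOp_closure_add_sq (hf : StrictMono f) (hf1 : ∀ n, 1 ≤ f n) (hc : ColumnsSummable f)
    (hs : Summable fun j => ‖column hc j‖ ^ 2 / f j ^ 4) {γ : ℝ} (hγ : γ ≠ 0) :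
    IsSelfAdjoint ((timeOp f).closure + (γ : ℂ) • opMul (funN f) (funN f)) ∧
      IsTimeOperator (funN f) ((timeOp f).closure + (γ : ℂ) • opMul (funN f) (funN f)) ∧
      ∃ D : Submodule ℂ EllTwo, Dense (D : Set EllTwo) ∧
        IsCCRDomain (funN f) ((timeOp f).closure + (γ : ℂ) • opMul (funN f) (funN f)) D := by
  have hcl := isClosable_timeOp hf hc
  have hsa := isSelfAdjoint_add_sq hcl.closure_isClosed
    (isFormalAdjoint_closure hcl hcl (isFormalAdjoint_timeOp hf))
    (mem_graph_closure_timeOp hf hc) hf1 hs hγ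
  have hccr := isCCRDomain_sumZero hf hc (mem_graph_closure_timeOp hf hc) γ
  have hsym := LinearPMap.adjoint_isFormalAdjoint hsa.dense_domain
  rw [LinearPMap.isSelfAdjoint_def.1 hsa] at hsym
  exact ⟨hsa, ⟨isSelfAdjoint_funN f, ⟨hsa.dense_domain, hsym⟩, _, hccr⟩, _, dense_sumZero, hccr⟩

end Columns

/-! ### Estimates for n^l + 1 -/

section Power

variable {l : ℝ}

/-- Bernoulli's inequality at x/y - 1: the concave power lies below its tangent at y. -/
lemma rpow_le_tangent (h0 : 0 ≤ l) (h1 : l ≤ 1) {x y : ℝ} (hx : 0 ≤ x) (hy : 0 < y) :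
    x ^ l ≤ y ^ l + l * (x - y) * y ^ (l - 1) := by
  have hb := rpow_one_add_le_one_add_mul_self (s := x / y - 1)
    (by have := div_nonneg hx hy.le; linarith) h0 h1
  rw [add_sub_cancel, Real.div_rpow hx hy.le, div_le_iff₀ (Real.rpow_pos_of_pos hy l)] at hb
  refine hb.trans_eq ?_
  rw [Real.rpow_sub_one hy.ne']
  field_simp

/-- The function `n ↦ n ^ l + 1`. -/
def powerFun (l : ℝ) (n : ℕ) : ℝ := (n : ℝ) ^ l + 1

lemma powerFun_sub_ge (h0 : 0 ≤ l) (h1 : l ≤ 1) {j n : ℕ} (h : j < n) :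
    l * ((n : ℝ) - j) * (n : ℝ) ^ (l - 1) ≤ powerFun l n - powerFun l j := by
  have := rpow_le_tangent h0 h1 (Nat.cast_nonneg j) (y := (n : ℝ))
    (by exact_mod_cast (Nat.zero_le j).trans_lt h)
  rw [powerFun, powerFun]
  linarith

lemma powerFun_sub_le (h0 : 0 ≤ l) (h1 : l ≤ 1) {j : ℕ} (hj : 0 < j) :
    powerFun l (j + 1) - powerFun l j ≤ l * (j : ℝ) ^ (l - 1) := by
  have := rpow_le_tangent h0 h1 (Nat.cast_nonneg (j + 1)) (y := (j : ℝ)) (by exact_mod_cast hj)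
  rw [powerFun, powerFun]
  push_cast at this ⊢
  linarith

lemma strictMono_powerFun (h0 : 0 < l) : StrictMono (powerFun l) := fun j n h => by
  have := Real.rpow_lt_rpow (Nat.cast_nonneg j) (Nat.cast_lt (α := ℝ).2 h) h0
  rw [powerFun, powerFun]
  linarith

lemma one_le_powerFun (n : ℕ) : 1 ≤ powerFun l n := by
  have := Real.rpow_nonneg (Nat.cast_nonneg (α := ℝ) n) l
  rw [powerFun]
  linarith

lemma rpow_le_powerFun (h0 : 0 ≤ l) (h1 : l ≤ 1) (n : ℕ) : ((n : ℝ) + 1) ^ l ≤ powerFun l n := by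
  have := Real.rpow_add_le_add_rpow (Nat.cast_nonneg (α := ℝ) n) zero_le_one h0 h1
  rwa [Real.one_rpow] at this

lemma powerFun_le (h0 : 0 ≤ l) (n : ℕ) : powerFun l n ≤ 2 * ((n : ℝ) + 1) ^ l := by
  have h1 : (n : ℝ) ^ l ≤ ((n : ℝ) + 1) ^ l :=
    Real.rpow_le_rpow (Nat.cast_nonneg n) (by linarith) h0
  have h2 : 1 ≤ ((n : ℝ) + 1) ^ l :=
    Real.one_le_rpow (by linarith [Nat.cast_nonneg (α := ℝ) n]) h0
  rw [powerFun]
  linarith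

lemma tendsto_powerFun_gap (h0 : 0 < l) (h1 : l < 1) :
    Tendsto (fun j => powerFun l (j + 1) - powerFun l j) atTop (𝓝 0) := by
  have hlim : Tendsto (fun j : ℕ => l * (j : ℝ) ^ (l - 1)) atTop (𝓝 0) := by
    have := ((tendsto_rpow_neg_atTop (sub_pos.2 h1)).comp tendsto_natCast_atTop_atTop).const_mul l
    simpa only [neg_sub, mul_zero, Function.comp_def] using this
  refine squeeze_zero' (Eventually.of_forall fun j => ?_) ?_ hlim
  · exact (sub_pos.2 (strictMono_powerFun h0 (Nat.lt_succ_self j))).le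
  · filter_upwards [eventually_gt_atTop 0] with j hj using powerFun_sub_le h0.le h1.le hj

/-- The tangent slope is taken at M = max(n, j). Since M ≤ (j+1)|n-j| and l - 1 ≤ 0, it splits into
a factor in j and a factor in the distance. -/
lemma abs_powerFun_sub_ge (h0 : 0 < l) (h1 : l ≤ 1) {j n : ℕ} (h : n ≠ j) :
    l * |(n : ℝ) - j| ^ l * ((j : ℝ) + 1) ^ (l - 1) ≤ |powerFun l n - powerFun l j| := by
  have hj0 : (0 : ℝ) ≤ j := Nat.cast_nonneg j
  have key : ∀ M k : ℝ, 0 < M → 1 ≤ k → M ≤ (j + 1) * k →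
      l * k ^ l * ((j : ℝ) + 1) ^ (l - 1) ≤ l * k * M ^ (l - 1) := by
    intro M k hM hk hMk
    have hk0 : 0 < k := one_pos.trans_le hk
    have h2 : (((j : ℝ) + 1) * k) ^ (l - 1) ≤ M ^ (l - 1) :=
      Real.rpow_le_rpow_of_nonpos hM hMk (by linarith)
    rw [Real.mul_rpow (by positivity) hk0.le] at h2
    calc l * k ^ l * ((j : ℝ) + 1) ^ (l - 1)
        = l * k * (((j : ℝ) + 1) ^ (l - 1) * k ^ (l - 1)) := by
          rw [Real.rpow_sub_one hk0.ne']
          field_simp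
      _ ≤ l * k * M ^ (l - 1) := by gcongr
  rcases lt_or_gt_of_ne h with h | h
  · have hc : (n : ℝ) + 1 ≤ j := by exact_mod_cast h
    have hn0 : (0 : ℝ) ≤ n := Nat.cast_nonneg n
    rw [abs_sub_comm, abs_sub_comm (powerFun l n), abs_of_pos (by linarith : (0 : ℝ) < j - n),
      abs_of_pos (sub_pos.2 (strictMono_powerFun h0 h))]
    exact (key j (j - n) (by linarith) (by linarith) (by nlinarith)).trans
      (powerFun_sub_ge h0.le h1 h)
  · have hc : (j : ℝ) + 1 ≤ n := by exact_mod_cast h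
    rw [abs_of_pos (by linarith : (0 : ℝ) < n - j),
      abs_of_pos (sub_pos.2 (strictMono_powerFun h0 h))]
    exact (key n (n - j) (by linarith) (by linarith) (by nlinarith)).trans
      (powerFun_sub_ge h0.le h1 h)

lemma inv_powerFun_sub_sq_le (h0 : 0 < l) (h1 : l ≤ 1) (j n : ℕ) :
    ((powerFun l n - powerFun l j)⁻¹) ^ 2 ≤
      (l⁻¹) ^ 2 * ((j : ℝ) + 1) ^ (2 - 2 * l) * |(((n : ℤ) - j : ℤ) : ℝ)| ^ (-(2 * l)) := by
  rcases eq_or_ne n j with rfl | h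
  · simp
    positivity
  have hpos : 0 < |(n : ℝ) - j| := abs_pos.2 (sub_ne_zero.2 (Nat.cast_injective.ne h))
  have hj : (0 : ℝ) < (j : ℝ) + 1 := by positivity
  have hL : 0 < l * |(n : ℝ) - j| ^ l * ((j : ℝ) + 1) ^ (l - 1) := by positivity
  have h2 := inv_anti₀ hL (abs_powerFun_sub_ge h0 h1 h)
  rw [← abs_inv] at h2
  rw [← sq_abs]
  refine (pow_le_pow_left₀ (abs_nonneg _) h2 2).trans_eq ?_
  push_cast
  rw [mul_inv, mul_inv, mul_pow, mul_pow, ← Real.rpow_neg hpos.le, ← Real.rpow_neg hj.le,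
    ← Real.rpow_mul_natCast hpos.le, ← Real.rpow_mul_natCast hj.le]
  rw [show -l * ((2 : ℕ) : ℝ) = -(2 * l) by push_cast; ring,
    show -(l - 1) * ((2 : ℕ) : ℝ) = 2 - 2 * l by push_cast; ring]
  ring

/-- Shifting by j embeds ℕ in ℤ, so one sum over ℤ bounds every column uniformly; the term at 0 is
harmless because `0 ^ (-b) = 0` here. -/
lemma summable_abs_sub_rpow {b : ℝ} (hb : 1 < b) (j : ℕ) :
    Summable (fun n : ℕ => |(((n : ℤ) - j : ℤ) : ℝ)| ^ (-b)) ∧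
      ∑' n : ℕ, |(((n : ℤ) - j : ℤ) : ℝ)| ^ (-b) ≤ ∑' z : ℤ, |(z : ℝ)| ^ (-b) := by
  have hs := Real.summable_abs_int_rpow hb
  have hi : Function.Injective fun n : ℕ => (n : ℤ) - j := fun a b h => by
    simpa using h
  exact ⟨hs.comp_injective hi, tsum_comp_le_tsum_of_inj hs (fun z => by positivity) hi⟩

lemma columnsSummable_powerFun (h0 : 1 / 2 < l) (h1 : l ≤ 1) : ColumnsSummable (powerFun l) :=
  fun j => ((summable_abs_sub_rpow (by linarith : 1 < 2 * l) j).1.mul_left _).of_nonneg_of_le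
    (fun _ => sq_nonneg _) (inv_powerFun_sub_sq_le (by linarith) h1 j)

lemma norm_column_powerFun_sq_le (h0 : 1 / 2 < l) (h1 : l ≤ 1) (j : ℕ) :
    ‖column (columnsSummable_powerFun h0 h1) j‖ ^ 2 ≤
      (l⁻¹) ^ 2 * ((j : ℝ) + 1) ^ (2 - 2 * l) * ∑' z : ℤ, |(z : ℝ)| ^ (-(2 * l)) := by
  obtain ⟨hs, hle⟩ := summable_abs_sub_rpow (by linarith : 1 < 2 * l) j
  rw [norm_column_sq]
  refine ((columnsSummable_powerFun h0 h1 j).tsum_le_tsum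
    (inv_powerFun_sub_sq_le (by linarith) h1 j) (hs.mul_left _)).trans ?_
  rw [tsum_mul_left]
  gcongr

lemma summable_succ_rpow {b : ℝ} (hb : b < -1) : Summable fun n : ℕ => ((n : ℝ) + 1) ^ b := by
  have := (summable_nat_add_iff 1).2 (Real.summable_nat_rpow.2 hb)
  simpa using this

lemma summable_norm_column_powerFun (h0 : 1 / 2 < l) (h1 : l ≤ 1) :
    Summable fun j => ‖column (columnsSummable_powerFun h0 h1) j‖ ^ 2 / powerFun l j ^ 4 := by
  -- Column norms contribute the exponent 2 - 2l and f⁴ contributes -4l; the total is below -1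
  -- exactly when l > 1/2.
  refine ((summable_succ_rpow (by linarith : 2 - 6 * l < -1)).mul_left
    ((l⁻¹) ^ 2 * ∑' z : ℤ, |(z : ℝ)| ^ (-(2 * l)))).of_nonneg_of_le (fun j => ?_) fun j => ?_
  · have := one_le_powerFun (l := l) j
    positivity
  · have hj : (0 : ℝ) < (j : ℝ) + 1 := by positivity
    have hp : 0 < ((j : ℝ) + 1) ^ (4 * l) := by positivity
    have h4 : ((j : ℝ) + 1) ^ (4 * l) ≤ powerFun l j ^ 4 := by
      rw [mul_comm, show (4 : ℝ) = ((4 : ℕ) : ℝ) by norm_num, Real.rpow_mul_natCast hj.le]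
      exact pow_le_pow_left₀ (by positivity) (rpow_le_powerFun (by linarith) h1 j) 4
    refine (div_le_div₀ ?_ (norm_column_powerFun_sq_le h0 h1 j) hp h4).trans_eq ?_
    · have : 0 ≤ ∑' z : ℤ, |(z : ℝ)| ^ (-(2 * l)) := tsum_nonneg fun z => by positivity
      positivity
    · rw [show 2 - 6 * l = (2 - 2 * l) - 4 * l by ring, Real.rpow_sub hj (2 - 2 * l)]
      ring

/-! ### Membership in the class 𝓜_s(1) -/

lemma powerFun_sq_sub_ge (h0 : 0 < l) (h1 : l ≤ 1) {j n : ℕ} (h : j < n) :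
    l * ((n : ℝ) - j) * (n : ℝ) ^ (l - 1) * ((n : ℝ) + 1) ^ l ≤
      powerFun l n ^ 2 - powerFun l j ^ 2 := by
  have h2 := powerFun_sub_ge h0.le h1 h
  have h3 := rpow_le_powerFun h0.le h1 n
  have h4 := one_le_powerFun (l := l) j
  have h5 := (sub_pos.2 (strictMono_powerFun h0 h)).le
  calc _ ≤ (powerFun l n - powerFun l j) * (powerFun l n + powerFun l j) :=
        mul_le_mul h2 (by linarith) (by positivity) h5
    _ = _ := by ring

/-- The weight `(n + 1) ^ (4 l - 1 / 2)`. -/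
def weight (l : ℝ) (n : ℕ) : ℝ := (((n : ℝ) + 1) ^ (2 * l - 1 / 4)) ^ 2

lemma powerFun_mem_classKMinus (h0 : 1 / 2 < l) (h1 : l ≤ 1) : powerFun l ∈ ClassKMinus := by
  refine ⟨⟨one_pos.trans_le (one_le_powerFun 0),
    fun n => strictMono_powerFun (by linarith) (Nat.lt_succ_self n)⟩, ?_⟩
  refine (summable_succ_rpow (by linarith : -(2 * l) < -1)).of_nonneg_of_le
    (fun n => sq_nonneg _) fun n => ?_
  have hn : (0 : ℝ) < (n : ℝ) + 1 := by positivity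
  rw [Real.rpow_neg hn.le, mul_comm, show (2 : ℝ) = ((2 : ℕ) : ℝ) by norm_num,
    Real.rpow_mul_natCast hn.le, ← inv_pow, one_div]
  have := one_le_powerFun (l := l) n
  exact pow_le_pow_left₀ (by positivity)
    (inv_anti₀ (by positivity) (rpow_le_powerFun (by linarith) h1 n)) 2

/-- Both summability conditions amount to l > 3/4: h decays like k^(-(l+1/4)), and f²/g like
(n+1)^(1/2-2l). -/
lemma isWitness_powerFun (hl : l ∈ Set.Ioo (3 / 4 : ℝ) 1) :
    IsWitness 1 (powerFun l) (weight l) fun k : ℕ+ => l⁻¹ * ((k : ℕ) : ℝ) ^ (-(l + 1 / 4)) := by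
  obtain ⟨hl0, hl1⟩ := hl
  have h0 : 0 < l := by linarith
  refine ⟨fun n => by rw [weight]; positivity, ?_, ?_, fun n k => ?_⟩
  · have h : Summable fun k : ℕ => l⁻¹ * (k : ℝ) ^ (-(l + 1 / 4)) :=
      (Real.summable_nat_rpow.2 (by linarith)).mul_left _
    exact (h.comp_injective PNat.coe_injective).abs
  · refine ((summable_succ_rpow (by linarith : 2 * (l - (2 * l - 1 / 4)) < -1)).mul_left
      4).of_nonneg_of_le (fun n => by rw [weight]; positivity) fun n => ?_
    have hn : (0 : ℝ) < (n : ℝ) + 1 := by positivity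
    have hp := one_le_powerFun (l := l) n
    have e : ((n : ℝ) + 1) ^ (2 * (l - (2 * l - 1 / 4))) =
        (((n : ℝ) + 1) ^ (l - (2 * l - 1 / 4))) ^ 2 := by
      rw [mul_comm]
      exact_mod_cast Real.rpow_mul_natCast hn.le _ 2
    rw [weight, ← div_pow, e, show (4 : ℝ) = 2 ^ 2 by norm_num, ← mul_pow,
      Real.rpow_sub hn l, ← mul_div_assoc]
    norm_num only
    refine pow_le_pow_left₀ (by positivity) ?_ 2
    gcongr
    exact powerFun_le h0.le n
  · have hk : (1 : ℝ) ≤ ((k : ℕ) : ℝ) := by exact_mod_cast k.2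
    have hk0 : (0 : ℝ) < ((k : ℕ) : ℝ) := by linarith
    have hn0 : (0 : ℝ) ≤ n := Nat.cast_nonneg n
    have hn : (0 : ℝ) < (n : ℝ) + 1 := by positivity
    have hnk : (0 : ℝ) < (n : ℝ) + (k : ℕ) := by positivity
    have h2 := powerFun_sq_sub_ge h0 hl1.le (j := n) (n := n + k) (by have := k.pos; omega)
    push_cast at h2
    rw [Real.rpow_one, weight, delta, ← div_pow]
    set D := powerFun l (n + k) ^ 2 - powerFun l n ^ 2 with hD
    -- The power (n+k)^(2l-1) is shared out as l - 1/4 to n + 1 and l - 3/4 to k, both at most n +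
    -- k; the exponents are nonnegative since l > 3/4.
    have h3 : l * ((k : ℕ) : ℝ) * (((n : ℝ) + 1) ^ (l - 1 / 4) * ((k : ℕ) : ℝ) ^ (l - 3 / 4)) ≤
        D := by
      refine le_trans ?_ h2
      rw [add_sub_cancel_left, mul_assoc (l * _)]
      refine mul_le_mul_of_nonneg_left ?_ (by positivity)
      calc ((n : ℝ) + 1) ^ (l - 1 / 4) * ((k : ℕ) : ℝ) ^ (l - 3 / 4)
          ≤ ((n : ℝ) + (k : ℕ)) ^ (l - 1 / 4) * ((n : ℝ) + (k : ℕ)) ^ (l - 3 / 4) := by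
            exact mul_le_mul (Real.rpow_le_rpow hn.le (by linarith) (by linarith))
              (Real.rpow_le_rpow hk0.le (by linarith) (by linarith)) (by positivity)
              (by positivity)
        _ = ((n : ℝ) + (k : ℕ)) ^ (l - 1) * ((n : ℝ) + (k : ℕ)) ^ l := by
            rw [← Real.rpow_add hnk, ← Real.rpow_add hnk]
            congr 1
            ring
        _ ≤ ((n : ℝ) + (k : ℕ)) ^ (l - 1) * ((n : ℝ) + (k : ℕ) + 1) ^ l :=
            mul_le_mul_of_nonneg_left (Real.rpow_le_rpow hnk.le (by linarith) h0.le)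
              (by positivity)
    have h4 : l * ((k : ℕ) : ℝ) ^ (l + 1 / 4) * ((n : ℝ) + 1) ^ (2 * l - 1 / 4) ≤
        powerFun l n * D := by
      calc _ = ((n : ℝ) + 1) ^ l * (l * ((k : ℕ) : ℝ) *
            (((n : ℝ) + 1) ^ (l - 1 / 4) * ((k : ℕ) : ℝ) ^ (l - 3 / 4))) := by
            rw [show 2 * l - 1 / 4 = l + (l - 1 / 4) by ring,
              show l + 1 / 4 = 1 + (l - 3 / 4) by ring, Real.rpow_add hn, Real.rpow_add hk0,
              Real.rpow_one]
            ring
        _ ≤ _ := mul_le_mul (rpow_le_powerFun h0.le hl1.le n) h3 (by positivity)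
            (zero_le_one.trans (one_le_powerFun n))
    have hpos : 0 < l * ((k : ℕ) : ℝ) ^ (l + 1 / 4) * ((n : ℝ) + 1) ^ (2 * l - 1 / 4) := by
      positivity
    refine pow_le_pow_left₀ (div_nonneg (by positivity) (hpos.trans_le h4).le) ?_ 2
    rw [div_le_iff₀ (hpos.trans_le h4), Real.rpow_neg hk0.le]
    calc ((n : ℝ) + 1) ^ (2 * l - 1 / 4) = l⁻¹ * (((k : ℕ) : ℝ) ^ (l + 1 / 4))⁻¹ *
          (l * ((k : ℕ) : ℝ) ^ (l + 1 / 4) * ((n : ℝ) + 1) ^ (2 * l - 1 / 4)) := by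
          field_simp
      _ ≤ _ := mul_le_mul_of_nonneg_left h4 (by positivity)

/-- With k = n - j, the identity n + 1 = k + (j+1) and subadditivity of the l-th power split the
quotient into a summable function of k plus one of j + 1. -/
lemma weight_div_le (hl : l ∈ Set.Ioo (3 / 4 : ℝ) 1) {j n : ℕ} (h : j < n) :
    weight l n / (powerFun l j * (powerFun l n ^ 2 - powerFun l j ^ 2)) ^ 2 ≤
      2 * (l⁻¹) ^ 2 * (((n - j : ℕ) : ℝ) ^ (-(2 * l)) + ((j + 1 : ℕ) : ℝ) ^ (-(2 * l))) := by
  obtain ⟨hl0, hl1⟩ := hl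
  have h0 : 0 < l := by linarith
  have hk : (1 : ℝ) ≤ (n : ℝ) - j := by
    have : (j : ℝ) + 1 ≤ n := by exact_mod_cast h
    linarith
  have hk0 : (0 : ℝ) < (n : ℝ) - j := by linarith
  have hj0 : (0 : ℝ) ≤ j := Nat.cast_nonneg j
  have hn0 : (0 : ℝ) < n := by linarith
  have hn : (0 : ℝ) < (n : ℝ) + 1 := by linarith
  have hj : (0 : ℝ) < (j : ℝ) + 1 := by linarith
  rw [Nat.cast_sub h.le]
  push_cast
  set k : ℝ := (n : ℝ) - j with hkdef
  have h2 := powerFun_sq_sub_ge h0 hl1.le h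
  set D := powerFun l n ^ 2 - powerFun l j ^ 2 with hD
  have h3 : l * k * ((n : ℝ) + 1) ^ (2 * l - 1) ≤ D := by
    refine le_trans ?_ h2
    rw [mul_assoc (l * k), show 2 * l - 1 = (l - 1) + l by ring, Real.rpow_add hn]
    gcongr l * k * (?_ * _)
    exact Real.rpow_le_rpow_of_nonpos hn0 (by linarith) (by linarith)
  have h4 : ((j : ℝ) + 1) ^ l * (l * k * ((n : ℝ) + 1) ^ (2 * l - 1)) ≤ powerFun l j * D :=
    mul_le_mul (rpow_le_powerFun h0.le hl1.le j) h3 (by positivity)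
      (zero_le_one.trans (one_le_powerFun j))
  have hpos : 0 < ((j : ℝ) + 1) ^ l * (l * k * ((n : ℝ) + 1) ^ (2 * l - 1)) := by positivity
  -- The surplus factor (n+1)^(3/4) is at most (n+1)^l, again because l > 3/4.
  have h5 : ((n : ℝ) + 1) ^ (2 * l - 1 / 4) ≤
      ((n : ℝ) + 1) ^ (2 * l - 1) * (k ^ l + ((j : ℝ) + 1) ^ l) := by
    rw [show 2 * l - 1 / 4 = (2 * l - 1) + 3 / 4 by ring, Real.rpow_add hn]
    refine mul_le_mul_of_nonneg_left ?_ (by positivity)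
    calc ((n : ℝ) + 1) ^ (3 / 4 : ℝ) ≤ ((n : ℝ) + 1) ^ l :=
          Real.rpow_le_rpow_of_exponent_le (by linarith) hl0.le
      _ = (k + ((j : ℝ) + 1)) ^ l := by rw [hkdef]; ring_nf
      _ ≤ _ := Real.rpow_add_le_add_rpow hk0.le hj.le h0.le hl1.le
  have h6 : k ^ l ≤ k := by
    simpa using Real.rpow_le_rpow_of_exponent_le hk hl1.le
  have h7 : ((n : ℝ) + 1) ^ (2 * l - 1 / 4) / (powerFun l j * D) ≤
      l⁻¹ * (k ^ (-l) + ((j : ℝ) + 1) ^ (-l)) := by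
    rw [div_le_iff₀ (hpos.trans_le h4), Real.rpow_neg hk0.le, Real.rpow_neg hj.le]
    calc _ ≤ _ := h5
      _ = l⁻¹ * ((k ^ l)⁻¹ + (((j : ℝ) + 1) ^ l)⁻¹) *
          (((j : ℝ) + 1) ^ l * (l * k ^ l * ((n : ℝ) + 1) ^ (2 * l - 1))) := by
          field_simp
          ring
      _ ≤ l⁻¹ * ((k ^ l)⁻¹ + (((j : ℝ) + 1) ^ l)⁻¹) *
          (((j : ℝ) + 1) ^ l * (l * k * ((n : ℝ) + 1) ^ (2 * l - 1))) := by gcongr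
      _ ≤ _ := by gcongr
  rw [weight, ← div_pow]
  refine (pow_le_pow_left₀ (div_nonneg (by positivity) (hpos.trans_le h4).le) h7 2).trans ?_
  have hsq : ∀ x : ℝ, 0 < x → x ^ (-(2 * l)) = (x ^ (-l)) ^ 2 := fun x hx => by
    rw [← Real.rpow_mul_natCast hx.le]
    congr 1
    push_cast
    ring
  rw [hsq k hk0, hsq _ hj, mul_pow, mul_comm (2 : ℝ), mul_assoc]
  refine mul_le_mul_of_nonneg_left ?_ (by positivity)
  nlinarith [sq_nonneg (k ^ (-l) - ((j : ℝ) + 1) ^ (-l))]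

theorem powerFun_mem_classMs (hl : l ∈ Set.Ioo (3 / 4 : ℝ) 1) : powerFun l ∈ ClassMs 1 := by
  obtain ⟨hl0, hl1⟩ := hl
  refine ⟨powerFun_mem_classKMinus (by linarith) hl1.le, weight l, _,
    isWitness_powerFun ⟨hl0, hl1⟩, ?_⟩
  have hs : Summable fun k : ℕ => (k : ℝ) ^ (-(2 * l)) :=
    Real.summable_nat_rpow.2 (by linarith)
  set Z := ∑' k : ℕ, (k : ℝ) ^ (-(2 * l)) with hZ
  have hZ0 : 0 ≤ Z := tsum_nonneg fun k => by positivity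
  have hle : ∀ n : ℕ, ∑ k ∈ Finset.Icc 1 n, (k : ℝ) ^ (-(2 * l)) ≤ Z := fun n =>
    hs.sum_le_tsum _ fun k _ => by positivity
  have hl' : 0 < l := by linarith
  -- The two Z bound the sums over k and over n - k + 1; the 1 makes the inequality strict.
  refine ⟨2 * (l⁻¹) ^ 2 * (Z + Z) + 1, by positivity, fun n => ?_⟩
  calc _ ≤ ∑ k ∈ Finset.Icc 1 n, 2 * (l⁻¹) ^ 2 *
        ((k : ℝ) ^ (-(2 * l)) + ((n - k + 1 : ℕ) : ℝ) ^ (-(2 * l))) := by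
        refine Finset.sum_le_sum fun k hk => ?_
        have hk' := Finset.mem_Icc.1 hk
        have h := weight_div_le ⟨hl0, hl1⟩ (by omega : n - k < n)
        rw [Nat.sub_sub_self hk'.2] at h
        rwa [Real.rpow_one]
    _ = 2 * (l⁻¹) ^ 2 * (∑ k ∈ Finset.Icc 1 n, (k : ℝ) ^ (-(2 * l)) +
        ∑ k ∈ Finset.Icc 1 n, (k : ℝ) ^ (-(2 * l))) := by
        rw [← Finset.mul_sum, Finset.sum_add_distrib]
        congr 2
        -- Reflection of {1, …, n} turns the second sum into the first.
        refine Finset.sum_nbij' (fun k => n - k + 1) (fun k => n - k + 1) ?_ ?_ ?_ ?_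
          fun _ _ => rfl
        all_goals
          intro k hk
          have hk' := Finset.mem_Icc.1 hk
          first | exact Finset.mem_Icc.2 (by omega) | omega
    _ ≤ 2 * (l⁻¹) ^ 2 * (Z + Z) := by
        gcongr <;> exact hle n
    _ < _ := lt_add_one _

end Power

end GalaponTime

end

theorem mainTheorem4 (l : ℝ) (hl : l ∈ Set.Ioo (3 / 4 : ℝ) 1)
    (f : ℕ → ℝ) (hf : ∀ n : ℕ, f n = (n : ℝ) ^ l + 1) :
    f ∈ GalaponTime.ClassMs 1 ∧
    GalaponTime.IsUnbounded (GalaponTime.timeOp f) ∧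
    (GalaponTime.timeOp f).IsClosable ∧
    ∀ γ : ℝ, γ ≠ 0 →
      IsSelfAdjoint ((GalaponTime.timeOp f).closure +
        (γ : ℂ) • GalaponTime.opMul (GalaponTime.funN f) (GalaponTime.funN f)) ∧
      GalaponTime.IsTimeOperator (GalaponTime.funN f) ((GalaponTime.timeOp f).closure +
        (γ : ℂ) • GalaponTime.opMul (GalaponTime.funN f) (GalaponTime.funN f)) ∧
      ∃ D : Submodule ℂ GalaponTime.EllTwo, Dense (D : Set GalaponTime.EllTwo) ∧
        GalaponTime.IsCCRDomain (GalaponTime.funN f) ((GalaponTime.timeOp f).closure +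
          (γ : ℂ) • GalaponTime.opMul (GalaponTime.funN f) (GalaponTime.funN f)) D := by
  obtain rfl : f = GalaponTime.powerFun l := funext hf
  have h0 : 1 / 2 < l := by linarith [hl.1]
  have h0' : 0 < l := by linarith
  have hm := GalaponTime.strictMono_powerFun h0'
  have hc := GalaponTime.columnsSummable_powerFun h0 hl.2.le
  exact ⟨GalaponTime.powerFun_mem_classMs hl,
    GalaponTime.isUnbounded_timeOp hm hc (GalaponTime.tendsto_powerFun_gap h0' hl.2),
    GalaponTime.isClosable_timeOp hm hc, fun γ hγ =>
    GalaponTime.timeOp_closure_add_sq hm GalaponTime.one_le_powerFun hc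
      (GalaponTime.summable_norm_column_powerFun h0 hl.2.le) hγ⟩
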